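/- **Theorem 4.3 (Stability of ARK with iterative refinement).** There are an absolute constant $K>0$ and polynomials $C_0,C_1$, positive at every $n\in\mathbb N$, such that the following holds for every $n$, every invertible $A\in\mathbb R^{n\times n}$ with rows $a_i^\top$, every $b\in\mathbb R^n$ and every $u>0$. Put $x=A^{-1}b$ and $\tilde\kappa=\|A\|_{\rm F}\|A^{-1}\|$, where $\|\cdot\|$ is the Euclidean norm and its operator norm. *Arithmetic.* Computations use a floating-point arithmetic with unit roundoff $u$ in the standard model: $\mathrm{fl}$ rounds a real number to a floating-point number (and fixes floating-point numbers) with $|\mathrm{fl}(z)-z|\le u|z|$, and for floating-point operands the computed value of $a\mathbin{\mathrm{op}}b$, $\mathrm{op}\in\{+,-,\times,\div\}$ (with nonzero divisor), is a floating-point number with error at most $u\,|a\mathbin{\mathrm{op}}b|$. The entries of $A$ and $b$ and the parameters $\lambda,\alpha,\beta,\gamma$ below enter the computation rounded by $\mathrm{fl}$; inner products are accumulated sequentially. *Parameters.* Either $\lambda=\|A\|_{\rm F}^2/n$, or $\lambda=0$ and $\max_i\|a_i\|^2\le 4\min_i\|a_i\|^2$. Let $$\tilde\mu=\frac{\sigma_{\min}^2(A)}{\|A\|_{\rm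 F}^2+n\lambda},\quad \tilde\nu=\frac{\|A\|_{\rm F}^2+n\lambda}{\min_i\|a_i\|^2+\lambda},\quad \beta=1-\sqrt{\tilde\mu/\tilde\nu},\quad \gamma=\frac1{\sqrt{\tilde\mu\tilde\nu}},\quad \alpha=\frac1{1+\gamma\tilde\nu}.$$ *ARK.* For a right-hand side $c$, start from $v_0=y_0=0$; iteration $j$ draws a row index $r$ with probability $(\|a_r\|^2+\lambda)/(\|A\|_{\rm F}^2+n\lambda)$ and sets $$x_j=\alpha v_j+(1-\alpha)y_j,\quad w_j=\frac{\langle a_r,x_j\rangle-c_r}{\|a_r\|^2+\lambda}\,a_r,\quad y_{j+1}=x_j-w_j,\quad v_{j+1}=\beta v_j+(1-\beta)x_j-\gamma w_j .$$ After $k$ iterations the output is $\mathrm{ARK}_k(c)=\alpha v_k+(1-\alpha)y_k$. *Iterative refinement.* $\hat x_0=\mathrm{ARK}_{k_0}(b)$ and $\hat x_{i+1}=\hat x_i+\mathrm{ARK}_{k_{i+1}}(b-A\hat x_i)$, with everything, including residuals and updates, evaluated in the same floating-point arithmetic, and all row draws independent. *Conclusion.* If $\tilde\kappa^2u\le 1/C_0(n)$,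 if the number of refinements satisfies $t\ge\lfloor\log_2(1/(\tilde\kappa u))\rfloor$, and if $k_i\ge K\,\tilde\kappa\sqrt n$ for $0\le i\le t$ (so that $k_i=\lceil K\tilde\kappa\sqrt n\,\rceil=\mathcal O(\tilde\kappa\sqrt n)$ iterations per solve suffice), then $$\mathbb E\|\hat x_t-x\|\le C_1(n)\,\|x\|\,\tilde\kappa\,u ,$$ i.e. the scheme is forward stable. -/

import Mathlib

open MeasureTheory ProbabilityTheory

noncomputable section

namespace ARK

/-- A floating-point arithmetic with unit roundoff `u`, in the standard model (no overflow or
underflow). `fl` rounds a real number to a floating-point number; the floating-point numbers (the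
exactly represented reals) are the fixed points of `fl`. The computed operations `add`, `sub`,
`mul`, `div` return floating-point numbers on floating-point operands, with relative error at most
`u`. Nothing is required of them on other operands, or of a division by zero. -/
structure FloatArith (u : ℝ) where
  fl : ℝ → ℝ
  add : ℝ → ℝ → ℝ
  sub : ℝ → ℝ → ℝ
  mul : ℝ → ℝ → ℝ
  div : ℝ → ℝ → ℝ
  fl_fl : ∀ x, fl (fl x) = fl x
  fl_err : ∀ x, |fl x - x| ≤ u * |x|
  fl_add : ∀ a b, fl a = a → fl b = b → fl (add a b) = add a b
  fl_sub : ∀ a b, fl a = a → fl b = b → fl (sub a b) = sub a b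
  fl_mul : ∀ a b, fl a = a → fl b = b → fl (mul a b) = mul a b
  fl_div : ∀ a b, fl a = a → fl b = b → b ≠ 0 → fl (div a b) = div a b
  add_err : ∀ a b, fl a = a → fl b = b → |add a b - (a + b)| ≤ u * |a + b|
  sub_err : ∀ a b, fl a = a → fl b = b → |sub a b - (a - b)| ≤ u * |a - b|
  mul_err : ∀ a b, fl a = a → fl b = b → |mul a b - a * b| ≤ u * |a * b|
  div_err : ∀ a b, fl a = a → fl b = b → b ≠ 0 → |div a b - a / b| ≤ u * |a / b|

namespace FloatArith

variable {u : ℝ} (F : FloatArith u) {n : ℕ}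

/-- Entrywise rounding of a vector. -/
def flVec (v : Fin n → ℝ) : Fin n → ℝ := fun j => F.fl (v j)

/-- Entrywise rounding of a matrix. -/
def flMat (A : Matrix (Fin n) (Fin n) ℝ) : Matrix (Fin n) (Fin n) ℝ :=
  Matrix.of fun i j => F.fl (A i j)

/-- Computed sum of vectors. -/
def vadd (v w : Fin n → ℝ) : Fin n → ℝ := fun j => F.add (v j) (w j)

/-- Computed difference of vectors. -/
def vsub (v w : Fin n → ℝ) : Fin n → ℝ := fun j => F.sub (v j) (w j)

/-- Computed product of a scalar and a vector. -/
def smul (c : ℝ) (v : Fin n → ℝ) : Fin n → ℝ := fun j => F.mul c (v j)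

/-- Computed inner product, accumulated from left to right. -/
def dot (v w : Fin n → ℝ) : ℝ :=
  Fin.foldl n (fun s j => F.add s (F.mul (v j) (w j))) 0

/-- Computed matrix-vector product. -/
def mulVec (M : Matrix (Fin n) (Fin n) ℝ) (v : Fin n → ℝ) : Fin n → ℝ :=
  fun i => F.dot (M i) v

end FloatArith

variable {n : ℕ}

/-- The Euclidean norm of a vector. -/
def norm2 (v : Fin n → ℝ) : ℝ := ‖WithLp.toLp 2 v‖

/-- The squared Euclidean norm `‖a_i‖²` of the `i`-th row. -/
def rowSq (A : Matrix (Fin n) (Fin n) ℝ) (i : Fin n) : ℝ := ∑ j, A i j ^ 2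

/-- The squared Frobenius norm. -/
def frobSq (A : Matrix (Fin n) (Fin n) ℝ) : ℝ := ∑ i, ∑ j, A i j ^ 2

/-- The Demmel condition number `‖A‖_F ‖A⁻¹‖`, with the `ℓ²` operator norm of `A⁻¹`. -/
def demmel (A : Matrix (Fin n) (Fin n) ℝ) : ℝ :=
  Real.sqrt (frobSq A) * ‖Matrix.toEuclideanCLM (𝕜 := ℝ) A⁻¹‖

/-- The smallest singular value (singular values are listed in decreasing order from index `0`). -/
def sigmaMin (A : Matrix (Fin n) (Fin n) ℝ) : ℝ :=
  (Matrix.toEuclideanLin A).singularValues (n - 1)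

/-- `μ̃ = σ_min(A)² / (‖A‖_F² + n λ)`. -/
def muT (A : Matrix (Fin n) (Fin n) ℝ) (lam : ℝ) : ℝ :=
  sigmaMin A ^ 2 / (frobSq A + n * lam)

/-- `ν̃ = (‖A‖_F² + n λ) / (min_i ‖a_i‖² + λ)`. -/
def nuT (A : Matrix (Fin n) (Fin n) ℝ) (lam : ℝ) : ℝ :=
  (frobSq A + n * lam) / ((⨅ i, rowSq A i) + lam)

/-- `β = 1 - √(μ̃ / ν̃)`. -/
def betaP (A : Matrix (Fin n) (Fin n) ℝ) (lam : ℝ) : ℝ :=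
  1 - Real.sqrt (muT A lam / nuT A lam)

/-- `γ = 1 / √(μ̃ ν̃)`. -/
def gammaP (A : Matrix (Fin n) (Fin n) ℝ) (lam : ℝ) : ℝ :=
  1 / Real.sqrt (muT A lam * nuT A lam)

/-- `α = 1 / (1 + γ ν̃)`. -/
def alphaP (A : Matrix (Fin n) (Fin n) ℝ) (lam : ℝ) : ℝ :=
  1 / (1 + gammaP A lam * nuT A lam)

/-- The two admissible choices of the regularization: either `λ = ‖A‖_F² / n`, or `λ = 0` for a
matrix whose rows are balanced, `max_i ‖a_i‖² ≤ 4 min_i ‖a_i‖²`. -/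
def AdmissibleReg (A : Matrix (Fin n) (Fin n) ℝ) (lam : ℝ) : Prop :=
  lam = frobSq A / n ∨ (lam = 0 ∧ ∀ i j, rowSq A i ≤ 4 * rowSq A j)

/-- The regularized sampling probability of row `i`, proportional to `‖a_i‖² + λ`. -/
def rowProb (A : Matrix (Fin n) (Fin n) ℝ) (lam : ℝ) (i : Fin n) : ℝ :=
  (rowSq A i + lam) / ∑ j, (rowSq A j + lam)

section Algorithm

variable {u : ℝ} (F : FloatArith u) (A : Matrix (Fin n) (Fin n) ℝ) (lam : ℝ)

/-- The computed point `x = α v + (1 - α) y`. -/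
def arkX (v y : Fin n → ℝ) : Fin n → ℝ :=
  F.vadd (F.smul (F.fl (alphaP A lam)) v)
    (F.smul (F.sub (F.fl 1) (F.fl (alphaP A lam))) y)

/-- The computed vector `w = ((⟨a_i, x⟩ - b_i) / (‖a_i‖² + λ)) a_i`, from the stored (rounded)
entries of `A` and the stored right-hand side `b`. -/
def arkW (b : Fin n → ℝ) (i : Fin n) (x : Fin n → ℝ) : Fin n → ℝ :=
  F.smul
    (F.div (F.sub (F.dot (F.flMat A i) x) (b i))
      (F.add (F.dot (F.flMat A i) (F.flMat A i)) (F.fl lam)))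
    (F.flMat A i)

/-- One computed iteration on the pair `(v, y)` with row `i`:
`y' = x - w`, `v' = β v + (1 - β) x - γ w`. -/
def arkStep (b : Fin n → ℝ) (i : Fin n) (s : (Fin n → ℝ) × (Fin n → ℝ)) :
    (Fin n → ℝ) × (Fin n → ℝ) :=
  let x := arkX F A lam s.1 s.2
  let w := arkW F A lam b i x
  (F.vsub
      (F.vadd (F.smul (F.fl (betaP A lam)) s.1)
        (F.smul (F.sub (F.fl 1) (F.fl (betaP A lam))) x))
      (F.smul (F.fl (gammaP A lam)) w),
    F.vsub x w)

/-- The computed pair `(v_k, y_k)`, started at `v_0 = y_0 = 0`; iteration `k` uses row `r k`. -/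
def arkState (b : Fin n → ℝ) (r : ℕ → Fin n) : ℕ → (Fin n → ℝ) × (Fin n → ℝ)
  | 0 => (0, 0)
  | k + 1 => arkStep F A lam b (r k) (arkState b r k)

/-- The computed output `x_k` of `k` iterations for the right-hand side `b`. -/
def arkSolve (b : Fin n → ℝ) (r : ℕ → Fin n) (k : ℕ) : Fin n → ℝ :=
  arkX F A lam (arkState F A lam b r k).1 (arkState F A lam b r k).2

/-- The computed iterates of iterative refinement, `x_0 = Solve(b)` and
`x_{i+1} = x_i + Solve(b - A x_i)`, all in the same arithmetic. Solve number `i` runs `k i`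
iterations and draws the rows `r i 0, r i 1, …`. -/
def refine (b : Fin n → ℝ) (r : ℕ → ℕ → Fin n) (k : ℕ → ℕ) : ℕ → Fin n → ℝ
  | 0 => arkSolve F A lam (F.flVec b) (r 0) (k 0)
  | i + 1 =>
    F.vadd (refine b r k i)
      (arkSolve F A lam
        (F.vsub (F.flVec b) (F.mulVec (F.flMat A) (refine b r k i)))
        (r (i + 1)) (k (i + 1)))

end Algorithm

end ARK

end

/-! Write σ for the smallest singular value, κ = ‖A‖_F / σ (the Demmel condition number), θ =
√(μ̃/ν̃), so that β = 1 - θ and α = θ/(1 + θ). The proof has three layers.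

Exact iteration. For the error (v, y) take the potential σ²‖A⁻ᵀv‖² + ‖y‖². Since A⁻ᵀa_i = e_i, a row
update moves a single coordinate of A⁻ᵀv, and averaging over the rows collapses the cross terms to
one inner product. The parameters make everything else cancel, and the expected potential shrinks by
1 - θ (`IsParam.sum_lyap_errStep_le`). Admissibility of λ gives θ ≥ 1/(2√n κ), whence the iteration
count κ√n (`exists_isParam`).

Rounded iteration. One computed step deviates from the exact one by O(nuκ) times error plus solution
norm (`arkStep_error`). The factor is κ and not κ²: v may be κ times larger than its share of the
potential, but it enters x with weight at most θ ≤ 1/κ. Such a perturbation is harmless once nuκ is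
a small multiple of θ, which is the hypothesis on κ²u (`rounding_small`). The contraction survives
as 1 - θ/4, and a solve leaves expected error at most a quarter of the solution norm
(`integral_arkSolve_le`).

Refinement. The computed residual, pulled back by A⁻¹, is the true correction up to O(nκu)(‖x‖ +
‖error‖) (`norm2_inv_residual_sub_le`). The draws of a solve are independent of the past, so
conditionally on the past each refinement at least halves the expected error up to an additive
O(nκu)‖x‖ (`integral_refine_succ_le`). After logarithmically many refinements only this additive
level remains. -/

namespace ARK

/-! ### Euclidean and Frobenius norm estimates -/

section Norm

variable {n : ℕ}

theorem norm2_nonneg (v : Fin n → ℝ) : 0 ≤ norm2 v := norm_nonneg _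

theorem norm2_sq (v : Fin n → ℝ) : norm2 v ^ 2 = ∑ j, v j ^ 2 := by
  simp [norm2, EuclideanSpace.real_norm_sq_eq]

theorem norm2_sq_eq_dotProduct (v : Fin n → ℝ) : norm2 v ^ 2 = v ⬝ᵥ v := by
  rw [norm2_sq]
  simp [dotProduct, sq]

@[simp] theorem norm2_zero : norm2 (0 : Fin n → ℝ) = 0 := by simp [norm2]

theorem norm2_add_le (v w : Fin n → ℝ) : norm2 (v + w) ≤ norm2 v + norm2 w := by
  simpa [norm2] using norm_add_le (WithLp.toLp 2 v) (WithLp.toLp 2 w)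

theorem norm2_sub_le (v w : Fin n → ℝ) : norm2 (v - w) ≤ norm2 v + norm2 w := by
  simpa [norm2] using norm_sub_le (WithLp.toLp 2 v) (WithLp.toLp 2 w)

theorem norm2_smul (c : ℝ) (v : Fin n → ℝ) : norm2 (c • v) = |c| * norm2 v := by
  simp [norm2, norm_smul]

@[simp] theorem norm2_neg (v : Fin n → ℝ) : norm2 (-v) = norm2 v := by
  simp [norm2]

theorem norm2_le_norm2_add (v w : Fin n → ℝ) : norm2 v ≤ norm2 w + norm2 (v - w) := by
  simpa using norm2_add_le w (v - w)

theorem norm2_le_mul {c : ℝ} (hc : 0 ≤ c) {v w : Fin n → ℝ} (h : ∀ j, |v j| ≤ c * |w j|) :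
    norm2 v ≤ c * norm2 w := by
  refine le_of_sq_le_sq ?_ (mul_nonneg hc (norm2_nonneg w))
  rw [mul_pow, norm2_sq, norm2_sq, Finset.mul_sum]
  refine Finset.sum_le_sum fun j _ => ?_
  rw [← sq_abs (v j), ← sq_abs (w j), ← mul_pow]
  exact pow_le_pow_left₀ (abs_nonneg _) (h j) 2

theorem abs_dotProduct_le (v w : Fin n → ℝ) : |v ⬝ᵥ w| ≤ norm2 v * norm2 w := by
  have := abs_real_inner_le_norm (WithLp.toLp 2 w) (WithLp.toLp 2 v)
  rw [EuclideanSpace.inner_eq_star_dotProduct] at this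
  simpa [norm2, mul_comm] using this

theorem sum_abs_mul_le (v w : Fin n → ℝ) : ∑ j, |v j * w j| ≤ norm2 v * norm2 w := by
  have h := abs_dotProduct_le (fun j => |v j|) (fun j => |w j|)
  have h1 : ∀ x : Fin n → ℝ, norm2 (fun j => |x j|) ≤ norm2 x := fun x => by
    simpa using norm2_le_mul (v := fun j => |x j|) (w := x) zero_le_one (by simp)
  calc ∑ j, |v j * w j| = (fun j => |v j|) ⬝ᵥ (fun j => |w j|) := by simp [dotProduct, abs_mul]
    _ ≤ _ := le_abs_self _
    _ ≤ _ := h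
    _ ≤ _ := mul_le_mul (h1 v) (h1 w) (norm2_nonneg _) (norm2_nonneg _)

variable (A : Matrix (Fin n) (Fin n) ℝ)

theorem rowSq_eq (i : Fin n) : rowSq A i = norm2 (A i) ^ 2 := (norm2_sq _).symm

theorem frobSq_eq : frobSq A = ∑ i, rowSq A i := rfl

theorem frobSq_nonneg : 0 ≤ frobSq A :=
  Finset.sum_nonneg fun _ _ => Finset.sum_nonneg fun _ _ => sq_nonneg _

theorem norm2_le_mul_sqrt_frobSq {c : ℝ} (hc : 0 ≤ c) {w : Fin n → ℝ}
    (h : ∀ i, |w i| ≤ c * norm2 (A i)) : norm2 w ≤ c * √(frobSq A) := by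
  refine le_of_sq_le_sq ?_ (by positivity)
  rw [mul_pow, Real.sq_sqrt (frobSq_nonneg A), norm2_sq, frobSq_eq, Finset.mul_sum]
  refine Finset.sum_le_sum fun i _ => ?_
  rw [rowSq_eq, ← mul_pow, ← sq_abs (w i)]
  exact pow_le_pow_left₀ (abs_nonneg _) (h i) 2

theorem norm2_mulVec_le (v : Fin n → ℝ) : norm2 (A.mulVec v) ≤ √(frobSq A) * norm2 v := by
  rw [mul_comm]
  refine norm2_le_mul_sqrt_frobSq A (norm2_nonneg v) fun i => ?_
  rw [mul_comm]
  exact abs_dotProduct_le _ _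

theorem frobSq_transpose : frobSq A.transpose = frobSq A := by
  simp only [frobSq, Matrix.transpose_apply]
  exact Finset.sum_comm

end Norm

/-! ### Forward error calculus for floating-point operations -/

namespace FloatArith

variable {u : ℝ} (F : FloatArith u) {n : ℕ}

/-- `x'` is a floating-point number approximating `x` up to `ε` times a bound `M` on `|x|`. -/
def ApproxScalar (ε x' x M : ℝ) : Prop := F.fl x' = x' ∧ |x| ≤ M ∧ |x' - x| ≤ ε * M

/-- `v'` is a floating-point vector approximating `v` up to `ε` times a bound `M` on its norm. -/
def Approx (ε : ℝ) (v' v : Fin n → ℝ) (M : ℝ) : Prop :=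
  (∀ j, F.fl (v' j) = v' j) ∧ norm2 v ≤ M ∧ norm2 (v' - v) ≤ ε * M

variable {F} {ε ε' M M' x x' y y' : ℝ} {v v' w w' : Fin n → ℝ}

theorem fl_zero (F : FloatArith u) : F.fl 0 = 0 := by simpa using F.fl_err 0

theorem ApproxScalar.bound_nonneg (h : F.ApproxScalar ε x' x M) : 0 ≤ M :=
  (abs_nonneg _).trans h.2.1

theorem Approx.bound_nonneg (h : F.Approx ε v' v M) : 0 ≤ M := (norm2_nonneg _).trans h.2.1

theorem ApproxScalar.mono (h : F.ApproxScalar ε x' x M) (hε : 0 ≤ ε) (h1 : ε ≤ ε') (h2 : M ≤ M') :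
    F.ApproxScalar ε' x' x M' :=
  ⟨h.1, h.2.1.trans h2, h.2.2.trans (mul_le_mul h1 h2 h.bound_nonneg (hε.trans h1))⟩

theorem Approx.mono (h : F.Approx ε v' v M) (hε : 0 ≤ ε) (h1 : ε ≤ ε') (h2 : M ≤ M') :
    F.Approx ε' v' v M' :=
  ⟨h.1, h.2.1.trans h2, h.2.2.trans (mul_le_mul h1 h2 h.bound_nonneg (hε.trans h1))⟩

theorem ApproxScalar.abs_le (h : F.ApproxScalar ε x' x M) : |x'| ≤ (1 + ε) * M := by
  have := abs_add_le x (x' - x)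
  rw [add_sub_cancel] at this
  linarith [h.2.1, h.2.2]

theorem Approx.norm2_le (h : F.Approx ε v' v M) : norm2 v' ≤ (1 + ε) * M := by
  linarith [norm2_le_norm2_add v' v, h.2.1, h.2.2]

theorem approxScalar_fl (h : u ≤ ε) (hM : |x| ≤ M) (hu : 0 ≤ u) :
    F.ApproxScalar ε (F.fl x) x M :=
  ⟨F.fl_fl x, hM, (F.fl_err x).trans (mul_le_mul h hM (abs_nonneg _) (hu.trans h))⟩

theorem approx_flVec (h : u ≤ ε) (hM : norm2 v ≤ M) (hu : 0 ≤ u) :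
    F.Approx ε (F.flVec v) v M :=
  ⟨fun j => F.fl_fl (v j), hM,
    (norm2_le_mul hu fun j => F.fl_err (v j)).trans
      (mul_le_mul h hM (norm2_nonneg _) (hu.trans h))⟩

theorem approx_self (hv : ∀ j, F.fl (v j) = v j) (hε : 0 ≤ ε) (hM : norm2 v ≤ M) :
    F.Approx ε v v M :=
  ⟨hv, hM, by simpa using mul_nonneg hε ((norm2_nonneg v).trans hM)⟩

theorem approxScalar_self (hx : F.fl x = x) (hε : 0 ≤ ε) (hM : |x| ≤ M) :
    F.ApproxScalar ε x x M :=
  ⟨hx, hM, by simpa using mul_nonneg hε ((abs_nonneg x).trans hM)⟩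

/-- The error is measured against the sum of the bounds and not against the result, so cancellation
does no harm. The crude factor 8 is shared by all the rules below, so the exponent of 8 counts the
depth of the computation. -/
theorem ApproxScalar.sub (hu : 0 ≤ u) (hε : u ≤ ε) (h1 : ε ≤ 1) (hx : F.ApproxScalar ε x' x M)
    (hy : F.ApproxScalar ε y' y M') : F.ApproxScalar (8 * ε) (F.sub x' y') (x - y) (M + M') := by
  have hM := hx.bound_nonneg
  have hM' := hy.bound_nonneg
  refine ⟨F.fl_sub _ _ hx.1 hy.1, (abs_sub x y).trans (add_le_add hx.2.1 hy.2.1), ?_⟩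
  have e1 := F.sub_err x' y' hx.1 hy.1
  have e2 : |x' - y'| ≤ 2 * (M + M') := by
    nlinarith [abs_sub x' y', hx.abs_le, hy.abs_le]
  have e3 := abs_add_three (F.sub x' y' - (x' - y')) (x' - x) (y - y')
  rw [abs_sub_comm y y'] at e3
  rw [show F.sub x' y' - (x - y) = F.sub x' y' - (x' - y') + (x' - x) + (y - y') by ring]
  have e4 : u * |x' - y'| ≤ ε * (2 * (M + M')) :=
    mul_le_mul hε e2 (abs_nonneg _) (hu.trans hε)
  nlinarith [hx.2.2, hy.2.2, mul_nonneg (hu.trans hε) hM, mul_nonneg (hu.trans hε) hM']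

theorem ApproxScalar.add (hu : 0 ≤ u) (hε : u ≤ ε) (h1 : ε ≤ 1) (hx : F.ApproxScalar ε x' x M)
    (hy : F.ApproxScalar ε y' y M') : F.ApproxScalar (8 * ε) (F.add x' y') (x + y) (M + M') := by
  have hM := hx.bound_nonneg
  have hM' := hy.bound_nonneg
  refine ⟨F.fl_add _ _ hx.1 hy.1, (abs_add_le x y).trans (add_le_add hx.2.1 hy.2.1), ?_⟩
  have e1 := F.add_err x' y' hx.1 hy.1
  have e2 : |x' + y'| ≤ 2 * (M + M') := by
    nlinarith [abs_add_le x' y', hx.abs_le, hy.abs_le]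
  have e3 := abs_add_three (F.add x' y' - (x' + y')) (x' - x) (y' - y)
  rw [show F.add x' y' - (x + y) = F.add x' y' - (x' + y') + (x' - x) + (y' - y) by ring]
  have e4 : u * |x' + y'| ≤ ε * (2 * (M + M')) :=
    mul_le_mul hε e2 (abs_nonneg _) (hu.trans hε)
  nlinarith [hx.2.2, hy.2.2, mul_nonneg (hu.trans hε) hM, mul_nonneg (hu.trans hε) hM']

/-- The divisor must be known with a genuine relative error, its bound being `y` itself. With ε ≤
1/2 the computed divisor stays above y/2, hence is nonzero. -/
theorem ApproxScalar.div (hu : 0 ≤ u) (hε : u ≤ ε) (h1 : ε ≤ 1 / 2) (hx : F.ApproxScalar ε x' x M)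
    (hy0 : 0 < y) (hy : F.ApproxScalar ε y' y y) :
    F.ApproxScalar (8 * ε) (F.div x' y') (x / y) (M / y) := by
  have hM := hx.bound_nonneg
  have hε0 := hu.trans hε
  have hy' : y / 2 ≤ y' := by nlinarith [(_root_.abs_le.1 hy.2.2).1]
  have hy'0 : 0 < y' := by linarith
  refine ⟨F.fl_div _ _ hx.1 hy.1 hy'0.ne', ?_, ?_⟩
  · rw [abs_div, abs_of_pos hy0]
    exact div_le_div_of_nonneg_right hx.2.1 hy0.le
  have e1 := F.div_err x' y' hx.1 hy.1 hy'0.ne'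
  have e2 : |x' / y'| ≤ 4 * (M / y) := by
    rw [abs_div, abs_of_pos hy'0, div_le_iff₀ hy'0]
    have : |x'| ≤ 2 * M := by nlinarith [hx.abs_le]
    calc |x'| ≤ 2 * M := this
      _ = 4 * (M / y) * (y / 2) := by field_simp; ring
      _ ≤ _ := by gcongr
  have e3 : |x' / y' - x / y| ≤ 4 * ε * (M / y) := by
    rw [show x' / y' - x / y = ((x' - x) * y - x * (y' - y)) / (y' * y) by field_simp; ring,
      abs_div, abs_of_pos (mul_pos hy'0 hy0), div_le_iff₀ (mul_pos hy'0 hy0)]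
    have a1 : |(x' - x) * y - x * (y' - y)| ≤ ε * M * y + M * (ε * y) := by
      refine (abs_sub _ _).trans ?_
      rw [abs_mul, abs_mul, abs_of_pos hy0]
      exact add_le_add (mul_le_mul_of_nonneg_right hx.2.2 hy0.le)
        (mul_le_mul hx.2.1 hy.2.2 (abs_nonneg _) hM)
    calc _ ≤ ε * M * y + M * (ε * y) := a1
      _ = 4 * ε * (M / y) * (y / 2 * y) := by field_simp; ring
      _ ≤ _ := by gcongr
  have e4 : u * |x' / y'| ≤ ε * (4 * (M / y)) := mul_le_mul hε e2 (abs_nonneg _) hε0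
  have e5 := abs_add_le (F.div x' y' - x' / y') (x' / y' - x / y)
  rw [sub_add_sub_cancel] at e5
  linarith

theorem Approx.vsub (hu : 0 ≤ u) (hε : u ≤ ε) (h1 : ε ≤ 1) (hv : F.Approx ε v' v M)
    (hw : F.Approx ε w' w M') : F.Approx (8 * ε) (F.vsub v' w') (v - w) (M + M') := by
  have hM := hv.bound_nonneg
  have hM' := hw.bound_nonneg
  refine ⟨fun j => F.fl_sub _ _ (hv.1 j) (hw.1 j),
    (norm2_sub_le v w).trans (add_le_add hv.2.1 hw.2.1), ?_⟩
  have e1 : norm2 (F.vsub v' w' - (v' - w')) ≤ u * norm2 (v' - w') :=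
    norm2_le_mul hu fun j => F.sub_err _ _ (hv.1 j) (hw.1 j)
  have e2 : norm2 (v' - w') ≤ 2 * (M + M') := by
    nlinarith [norm2_sub_le v' w', hv.norm2_le, hw.norm2_le]
  have e3 := norm2_add_le (F.vsub v' w' - (v' - w')) ((v' - v) - (w' - w))
  have e5 := norm2_sub_le (v' - v) (w' - w)
  rw [show F.vsub v' w' - (v - w) = F.vsub v' w' - (v' - w') + ((v' - v) - (w' - w)) by abel]
  have e4 : u * norm2 (v' - w') ≤ ε * (2 * (M + M')) :=
    mul_le_mul hε e2 (norm2_nonneg _) (hu.trans hε)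
  nlinarith [hv.2.2, hw.2.2, mul_nonneg (hu.trans hε) hM, mul_nonneg (hu.trans hε) hM']

theorem Approx.vadd (hu : 0 ≤ u) (hε : u ≤ ε) (h1 : ε ≤ 1) (hv : F.Approx ε v' v M)
    (hw : F.Approx ε w' w M') : F.Approx (8 * ε) (F.vadd v' w') (v + w) (M + M') := by
  have hM := hv.bound_nonneg
  have hM' := hw.bound_nonneg
  refine ⟨fun j => F.fl_add _ _ (hv.1 j) (hw.1 j),
    (norm2_add_le v w).trans (add_le_add hv.2.1 hw.2.1), ?_⟩
  have e1 : norm2 (F.vadd v' w' - (v' + w')) ≤ u * norm2 (v' + w') :=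
    norm2_le_mul hu fun j => F.add_err _ _ (hv.1 j) (hw.1 j)
  have e2 : norm2 (v' + w') ≤ 2 * (M + M') := by
    nlinarith [norm2_add_le v' w', hv.norm2_le, hw.norm2_le]
  have e3 := norm2_add_le (F.vadd v' w' - (v' + w')) ((v' - v) + (w' - w))
  have e5 := norm2_add_le (v' - v) (w' - w)
  rw [show F.vadd v' w' - (v + w) = F.vadd v' w' - (v' + w') + ((v' - v) + (w' - w)) by abel]
  have e4 : u * norm2 (v' + w') ≤ ε * (2 * (M + M')) :=
    mul_le_mul hε e2 (norm2_nonneg _) (hu.trans hε)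
  nlinarith [hv.2.2, hw.2.2, mul_nonneg (hu.trans hε) hM, mul_nonneg (hu.trans hε) hM']

theorem ApproxScalar.smul (hu : 0 ≤ u) (hε : u ≤ ε) (h1 : ε ≤ 1) (hx : F.ApproxScalar ε x' x M)
    (hv : F.Approx ε v' v M') : F.Approx (8 * ε) (F.smul x' v') (x • v) (M * M') := by
  have hM := hx.bound_nonneg
  have hM' := hv.bound_nonneg
  have hε0 := hu.trans hε
  refine ⟨fun j => F.fl_mul _ _ hx.1 (hv.1 j), ?_, ?_⟩
  · rw [norm2_smul]
    exact mul_le_mul hx.2.1 hv.2.1 (norm2_nonneg _) hM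
  have e1 : norm2 (F.smul x' v' - x' • v') ≤ u * norm2 (x' • v') :=
    norm2_le_mul hu fun j => F.mul_err _ _ hx.1 (hv.1 j)
  have hx' : |x'| ≤ 2 * M := by nlinarith [hx.abs_le]
  have hv' : norm2 v' ≤ 2 * M' := by nlinarith [hv.norm2_le]
  have e2 : norm2 (x' • v') ≤ 2 * M * (2 * M') := by
    rw [norm2_smul]
    exact mul_le_mul hx' hv' (norm2_nonneg _) (by positivity)
  have e3 := norm2_add_le (F.smul x' v' - x' • v') ((x' - x) • v' + x • (v' - v))
  have e5 := norm2_add_le ((x' - x) • v') (x • (v' - v))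
  rw [norm2_smul, norm2_smul] at e5
  have e6 : |x' - x| * norm2 v' ≤ ε * M * (2 * M') :=
    mul_le_mul hx.2.2 hv' (norm2_nonneg _) (by positivity)
  have e7 : |x| * norm2 (v' - v) ≤ M * (ε * M') :=
    mul_le_mul hx.2.1 hv.2.2 (norm2_nonneg _) hM
  rw [show F.smul x' v' - x • v = F.smul x' v' - x' • v' + ((x' - x) • v' + x • (v' - v)) by
    rw [sub_smul, smul_sub]; abel]
  have e4 : u * norm2 (x' • v') ≤ ε * (2 * M * (2 * M')) :=
    mul_le_mul hε e2 (norm2_nonneg _) hε0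
  nlinarith [mul_nonneg hε0 (mul_nonneg hM hM')]

/-- The exponent n + 1 counts one product and n additions: the sum starts from 0, and even the
addition to 0 may round. -/
theorem dot_spec (F : FloatArith u) (hu : 0 ≤ u) : ∀ (n : ℕ) (v w : Fin n → ℝ),
    (∀ j, F.fl (v j) = v j) → (∀ j, F.fl (w j) = w j) →
    F.fl (F.dot v w) = F.dot v w ∧
      |F.dot v w - v ⬝ᵥ w| ≤ ((1 + u) ^ (n + 1) - 1) * ∑ j, |v j * w j|
  | 0, v, w, _, _ => by simp [dot, F.fl_zero]
  | n + 1, v, w, hv, hw => by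
    obtain ⟨h1, h2⟩ := dot_spec F hu n (fun j => v j.castSucc) (fun j => w j.castSucc)
      (fun j => hv _) (fun j => hw _)
    set s := F.dot (fun j => v j.castSucc) (fun j => w j.castSucc) with hs
    have hrec : F.dot v w = F.add s (F.mul (v (Fin.last n)) (w (Fin.last n))) := by
      rw [dot, Fin.foldl_succ_last]
      rfl
    have hp := F.mul_err _ _ (hv (Fin.last n)) (hw (Fin.last n))
    have hpf := F.fl_mul _ _ (hv (Fin.last n)) (hw (Fin.last n))
    have hdot : v ⬝ᵥ w = (fun j : Fin n => v j.castSucc) ⬝ᵥ (fun j => w j.castSucc)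
        + v (Fin.last n) * w (Fin.last n) := by
      simp [dotProduct, Fin.sum_univ_castSucc]
    have hd : |(fun j : Fin n => v j.castSucc) ⬝ᵥ (fun j => w j.castSucc)|
        ≤ ∑ j : Fin n, |v j.castSucc * w j.castSucc| := Finset.abs_sum_le_sum_abs _ _
    rw [hrec, hdot, Fin.sum_univ_castSucc]
    refine ⟨F.fl_add _ _ h1 hpf, ?_⟩
    have ha := F.add_err _ _ h1 hpf
    set p := v (Fin.last n) * w (Fin.last n)
    set p' := F.mul (v (Fin.last n)) (w (Fin.last n))
    set d := (fun j : Fin n => v j.castSucc) ⬝ᵥ (fun j => w j.castSucc)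
    set T := ∑ j : Fin n, |v j.castSucc * w j.castSucc|
    have hT : 0 ≤ T := Finset.sum_nonneg fun _ _ => abs_nonneg _
    have b1 : |s + p' - (d + p)| ≤ |s - d| + |p' - p| := by
      rw [show s + p' - (d + p) = (s - d) + (p' - p) by ring]
      exact abs_add_le _ _
    have b2 : |s + p'| ≤ |d| + |p| + |s + p' - (d + p)| := by
      have := abs_add_three d p (s + p' - (d + p))
      rwa [show d + p + (s + p' - (d + p)) = s + p' by ring] at this
    have b3 : |F.add s p' - (d + p)| ≤ |F.add s p' - (s + p')| + |s + p' - (d + p)| := by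
      have := abs_add_le (F.add s p' - (s + p')) (s + p' - (d + p))
      rwa [sub_add_sub_cancel] at this
    have hq : (1 + u) ^ 2 ≤ (1 + u) ^ (n + 2) := pow_le_pow_right₀ (by linarith) (by lia)
    have hq' : (1 + u) ^ (n + 2) = (1 + u) * (1 + u) ^ (n + 1) := by ring
    have key : |F.add s p' - (d + p)| ≤
        (1 + u) * (((1 + u) ^ (n + 1) - 1) * T + u * |p|) + u * (T + |p|) := by
      have : |s + p' - (d + p)| ≤ ((1 + u) ^ (n + 1) - 1) * T + u * |p| := by linarith
      have h3 : u * |s + p'| ≤ u * (T + |p| + (((1 + u) ^ (n + 1) - 1) * T + u * |p|)) :=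
        mul_le_mul_of_nonneg_left (by linarith) hu
      linarith
    refine key.trans ?_
    have h4 : (1 + u) ^ 2 * |p| ≤ (1 + u) ^ (n + 2) * |p| :=
      mul_le_mul_of_nonneg_right hq (abs_nonneg _)
    rw [show n + 1 + 1 = n + 2 by ring]
    rw [hq'] at h4 ⊢
    nlinarith

theorem one_add_pow_sub_one_le (hu : 0 ≤ u) {k : ℕ} (hk : k * u ≤ 1) :
    (1 + u) ^ k - 1 ≤ 2 * (k * u) := by
  have h1 : (1 + u) ^ k ≤ Real.exp (k * u) := by
    rw [Real.exp_nat_mul]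
    exact pow_le_pow_left₀ (by linarith) (by linarith [Real.add_one_le_exp u]) k
  have h0 : 0 ≤ k * u := by positivity
  have h2 := (abs_le.1 (Real.abs_exp_sub_one_sub_id_le (x := k * u) (by rwa [abs_of_nonneg h0]))).2
  nlinarith

theorem Approx.dot (hu : 0 ≤ u) (hε : 4 * ((n + 2) * u) ≤ ε) (h1 : ε ≤ 1)
    (hv : F.Approx ε v' v M) (hw : F.Approx ε w' w M') :
    F.ApproxScalar (8 * ε) (F.dot v' w') (v ⬝ᵥ w) (M * M') := by
  have hM := hv.bound_nonneg
  have hM' := hw.bound_nonneg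
  obtain ⟨f1, f2⟩ := dot_spec F hu n v' w' hv.1 hw.1
  have hnu : (0 : ℝ) ≤ (n + 2) * u := by positivity
  have hε0 : 0 ≤ ε := by linarith
  refine ⟨f1, (abs_dotProduct_le v w).trans
    (mul_le_mul hv.2.1 hw.2.1 (norm2_nonneg _) hM), ?_⟩
  have hv' : norm2 v' ≤ 2 * M := by nlinarith [hv.norm2_le]
  have hw' : norm2 w' ≤ 2 * M' := by nlinarith [hw.norm2_le]
  have e0 : ((1 + u) ^ (n + 1) - 1) ≤ ε / 2 := by
    have := one_add_pow_sub_one_le hu (k := n + 1) (by push_cast; nlinarith)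
    push_cast at this
    nlinarith
  have e1 : |F.dot v' w' - v' ⬝ᵥ w'| ≤ ε / 2 * (2 * M * (2 * M')) :=
    f2.trans (mul_le_mul e0 ((sum_abs_mul_le v' w').trans
      (mul_le_mul hv' hw' (norm2_nonneg _) (by positivity)))
      (Finset.sum_nonneg fun _ _ => abs_nonneg _) (by positivity))
  have e2 : |(v' - v) ⬝ᵥ w'| ≤ ε * M * (2 * M') :=
    (abs_dotProduct_le _ _).trans (mul_le_mul hv.2.2 hw' (norm2_nonneg _) (by positivity))
  have e3 : |v ⬝ᵥ (w' - w)| ≤ M * (ε * M') :=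
    (abs_dotProduct_le _ _).trans (mul_le_mul hv.2.1 hw.2.2 (norm2_nonneg _) hM)
  have e4 := abs_add_three (F.dot v' w' - v' ⬝ᵥ w') ((v' - v) ⬝ᵥ w') (v ⬝ᵥ (w' - w))
  rw [show F.dot v' w' - v' ⬝ᵥ w' + (v' - v) ⬝ᵥ w' + v ⬝ᵥ (w' - w) = F.dot v' w' - v ⬝ᵥ w by
    rw [sub_dotProduct, dotProduct_sub]; ring] at e4
  nlinarith [mul_nonneg hε0 (mul_nonneg hM hM')]

end FloatArith

/-! ### The Lyapunov function and its contraction by an exact iteration -/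

section Lyapunov

variable {n : ℕ}

/-- The properties of the smallest singular value `σ` and of the parameters `θ = √(μ̃ / ν̃)` and
`γ` on which the analysis of the iteration rests. -/
structure IsParam (A : Matrix (Fin n) (Fin n) ℝ) (lam σ θ γ : ℝ) : Prop where
  det : IsUnit A.det
  lam_nonneg : 0 ≤ lam
  sigma_pos : 0 < σ
  sigma_inv : ∀ w, σ * norm2 (A⁻¹.mulVec w) ≤ norm2 w
  sigma_le : σ ≤ √(frobSq A)
  theta_pos : 0 < θ
  theta_le_one : θ ≤ 1
  gamma_pos : 0 < γ
  gamma_sq : ∀ i, γ ^ 2 * σ ^ 2 ≤ rowSq A i + lam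
  gamma_sigma : γ * σ ^ 2 = θ * (frobSq A + n * lam)
  theta_frob : θ * √(frobSq A) ≤ σ
  gamma_le : γ * σ ≤ 2 * √(frobSq A)
  theta_ge : σ ≤ 2 * √n * √(frobSq A) * θ

variable {A : Matrix (Fin n) (Fin n) ℝ} {lam σ θ γ : ℝ}

theorem rowSq_nonneg (A : Matrix (Fin n) (Fin n) ℝ) (i : Fin n) : 0 ≤ rowSq A i :=
  Finset.sum_nonneg fun _ _ => sq_nonneg _

namespace IsParam

variable (h : IsParam A lam σ θ γ)
include h

theorem weight_pos (i : Fin n) : 0 < rowSq A i + lam :=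
  (mul_pos (pow_pos h.gamma_pos 2) (pow_pos h.sigma_pos 2)).trans_le (h.gamma_sq i)

/-- Duality: for w = A⁻ᵀv one has ‖w‖² = ⟨v, A⁻¹w⟩ ≤ ‖v‖ ‖w‖ / σ. -/
theorem sigma_inv_transpose (v : Fin n → ℝ) :
    σ * norm2 ((A⁻¹).transpose.mulVec v) ≤ norm2 v := by
  set w := (A⁻¹).transpose.mulVec v with hw
  have h1 : norm2 w ^ 2 = v ⬝ᵥ A⁻¹.mulVec w := by
    rw [norm2_sq_eq_dotProduct]
    nth_rewrite 1 [hw]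
    rw [Matrix.mulVec_transpose, ← Matrix.dotProduct_mulVec]
  have h2 := (le_abs_self _).trans (abs_dotProduct_le v (A⁻¹.mulVec w))
  have h3 := h.sigma_inv w
  rcases (norm2_nonneg w).eq_or_lt with h0 | h0
  · rw [← h0, mul_zero]; exact norm2_nonneg v
  · have : σ * norm2 w * norm2 w ≤ norm2 v * norm2 w := by
      have := mul_le_mul_of_nonneg_left h3 (norm2_nonneg v)
      have := mul_le_mul_of_nonneg_left h2 h.sigma_pos.le
      rw [← h1] at this
      linarith
    exact le_of_mul_le_mul_right this h0

/-- This is why v is measured through A⁻ᵀ: a step along the row a_i becomes a step along one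
coordinate vector, whose norm does not depend on the row. -/
theorem inv_transpose_row (i : Fin n) :
    (A⁻¹).transpose.mulVec (A i) = Pi.single i 1 := by
  rw [Matrix.mulVec_transpose]
  have := congrFun (Matrix.mul_nonsing_inv A h.det) i
  ext j
  have hj := congrFun this j
  rw [Matrix.mul_apply] at hj
  simp only [Matrix.vecMul, dotProduct]
  rw [hj, Matrix.one_apply, Pi.single_apply]
  simp [eq_comm]

theorem mulVec_dotProduct (x w : Fin n → ℝ) :
    A.mulVec x ⬝ᵥ (A⁻¹).transpose.mulVec w = x ⬝ᵥ w := by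
  rw [Matrix.mulVec_transpose, dotProduct_comm, ← Matrix.dotProduct_mulVec, Matrix.mulVec_mulVec,
    Matrix.nonsing_inv_mul A h.det, Matrix.one_mulVec, dotProduct_comm]

end IsParam

/-- The error `(v - z, y - z)` after one exact iteration with row `i`, as a function of the error
before it. -/
noncomputable def errStep (A : Matrix (Fin n) (Fin n) ℝ) (lam θ γ : ℝ) (i : Fin n)
    (s : (Fin n → ℝ) × (Fin n → ℝ)) : (Fin n → ℝ) × (Fin n → ℝ) :=
  let x := (θ / (1 + θ)) • s.1 + (1 - θ / (1 + θ)) • s.2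
  let w := ((A i ⬝ᵥ x) / (rowSq A i + lam)) • A i
  ((1 - θ) • s.1 + θ • x - γ • w, x - w)

/-- The Lyapunov function `σ² ‖A⁻ᵀ v‖² + ‖y‖²` of the error `(v, y)`. -/
noncomputable def lyap (A : Matrix (Fin n) (Fin n) ℝ) (σ : ℝ)
    (s : (Fin n → ℝ) × (Fin n → ℝ)) : ℝ :=
  σ ^ 2 * norm2 ((A⁻¹).transpose.mulVec s.1) ^ 2 + norm2 s.2 ^ 2

theorem norm2_sub_smul_sq (v w : Fin n → ℝ) (c : ℝ) :
    norm2 (v - c • w) ^ 2 = norm2 v ^ 2 - 2 * c * (w ⬝ᵥ v) + c ^ 2 * norm2 w ^ 2 := by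
  simp only [norm2_sq_eq_dotProduct, sub_dotProduct, dotProduct_sub, smul_dotProduct,
    dotProduct_smul, smul_eq_mul, dotProduct_comm v w]
  ring

theorem norm2_convex_sq (v w : Fin n → ℝ) {t : ℝ} (h0 : 0 ≤ t) (h1 : t ≤ 1) :
    norm2 ((1 - t) • v + t • w) ^ 2 ≤ (1 - t) * norm2 v ^ 2 + t * norm2 w ^ 2 := by
  have h := norm2_add_le ((1 - t) • v) (t • w)
  rw [norm2_smul, norm2_smul, abs_of_nonneg h0, abs_of_nonneg (sub_nonneg.2 h1)] at h
  refine (pow_le_pow_left₀ (norm2_nonneg _) h 2).trans ?_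
  nlinarith [mul_nonneg (mul_nonneg h0 (sub_nonneg.2 h1)) (sq_nonneg (norm2 v - norm2 w))]

/-- One exact iteration contracts the Lyapunov function by `1 - θ` in expectation. -/
theorem IsParam.sum_lyap_errStep_le (h : IsParam A lam σ θ γ) (s : (Fin n → ℝ) × (Fin n → ℝ)) :
    ∑ i, rowProb A lam i * lyap A σ (errStep A lam θ γ i s) ≤ (1 - θ) * lyap A σ s := by
  have hθ := h.theta_pos
  obtain ⟨v, y⟩ := s
  set x : Fin n → ℝ := (θ / (1 + θ)) • v + (1 - θ / (1 + θ)) • y with hx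
  set p : Fin n → ℝ := (1 - θ) • v + θ • x with hp
  set B := (A⁻¹).transpose
  set S : ℝ := ∑ j, (rowSq A j + lam) with hS
  have hSeq : S = frobSq A + n * lam := by
    rw [hS, Finset.sum_add_distrib, frobSq_eq]; simp
  have hSpos : 0 < S := by
    have : 0 < θ * S := by
      rw [hSeq, ← h.gamma_sigma]; exact mul_pos h.gamma_pos (pow_pos h.sigma_pos 2)
    exact pos_of_mul_pos_right this hθ.le
  -- The coupling that dictates α = θ/(1 + θ), in the equivalent form (1 + θ)x = θv + y.
  have hθp : θ • p = x - (1 - θ) • y := by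
    rw [hp, hx]
    ext j
    simp only [Pi.smul_apply, Pi.add_apply, Pi.sub_apply, smul_eq_mul]
    field_simp
    ring
  have hrow : ∀ i, (rowSq A i + lam) * lyap A σ (errStep A lam θ γ i (v, y)) ≤
      (rowSq A i + lam) * (σ ^ 2 * norm2 (B.mulVec p) ^ 2 + norm2 x ^ 2)
        - 2 * γ * σ ^ 2 * (A.mulVec x i * B.mulVec p i) := by
    intro i
    have hq := h.weight_pos i
    have e1 : lyap A σ (errStep A lam θ γ i (v, y)) =
        σ ^ 2 * norm2 (B.mulVec p - (γ * (A.mulVec x i / (rowSq A i + lam))) •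
          (Pi.single i 1 : Fin n → ℝ)) ^ 2 +
          norm2 (x - (A.mulVec x i / (rowSq A i + lam)) • A i) ^ 2 := by
      rw [lyap, errStep, ← h.inv_transpose_row i, ← Matrix.mulVec_smul, ← Matrix.mulVec_sub,
        mul_smul]
      rfl
    have e2 : norm2 (Pi.single i 1 : Fin n → ℝ) ^ 2 = 1 := by
      simp [norm2_sq_eq_dotProduct]
    have e3 : (A i ⬝ᵥ x) = A.mulVec x i := rfl
    rw [e1, norm2_sub_smul_sq, norm2_sub_smul_sq, e2, single_dotProduct, e3, ← rowSq_eq]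
    set g := A.mulVec x i
    set q := rowSq A i + lam with hqdef
    have e4 : q * (σ ^ 2 * (norm2 (B.mulVec p) ^ 2 - 2 * (γ * (g / q)) * (1 * B.mulVec p i) +
          (γ * (g / q)) ^ 2 * 1) + (norm2 x ^ 2 - 2 * (g / q) * g + (g / q) ^ 2 * rowSq A i)) =
        q * (σ ^ 2 * norm2 (B.mulVec p) ^ 2 + norm2 x ^ 2)
          - 2 * γ * σ ^ 2 * (g * B.mulVec p i)
          + (γ ^ 2 * σ ^ 2 + rowSq A i - 2 * q) * g ^ 2 / q := by
      field_simp
      ring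
    rw [e4]
    -- Both γ²σ² and ‖a_i‖² are at most q, so the gain 2g²/q of the y-update pays for the squared
    -- lengths of both updates.
    have e5 : (γ ^ 2 * σ ^ 2 + rowSq A i - 2 * q) * g ^ 2 / q ≤ 0 := by
      refine div_nonpos_of_nonpos_of_nonneg ?_ hq.le
      refine mul_nonpos_of_nonpos_of_nonneg ?_ (sq_nonneg g)
      linarith [h.gamma_sq i, h.lam_nonneg]
    linarith
  have hsum : ∑ i, (rowSq A i + lam) * lyap A σ (errStep A lam θ γ i (v, y)) ≤
      S * (σ ^ 2 * norm2 (B.mulVec p) ^ 2 + norm2 x ^ 2 - 2 * (x ⬝ᵥ (θ • p))) := by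
    refine (Finset.sum_le_sum fun i _ => hrow i).trans_eq ?_
    rw [Finset.sum_sub_distrib, ← Finset.sum_mul, ← Finset.mul_sum, ← hS]
    -- The weights q cancel the denominators, so the row average is ⟨Ax, A⁻ᵀp⟩ = ⟨x, p⟩; then γσ² =
    -- θS turns its coefficient into θ.
    have : ∑ i, A.mulVec x i * B.mulVec p i = x ⬝ᵥ p := h.mulVec_dotProduct x p
    rw [this, dotProduct_smul, smul_eq_mul, mul_assoc 2 γ, h.gamma_sigma, ← hSeq]
    ring
  have hfin : σ ^ 2 * norm2 (B.mulVec p) ^ 2 + norm2 x ^ 2 - 2 * (x ⬝ᵥ (θ • p)) ≤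
      (1 - θ) * lyap A σ (v, y) := by
    have c1 : norm2 (B.mulVec p) ^ 2 ≤
        (1 - θ) * norm2 (B.mulVec v) ^ 2 + θ * norm2 (B.mulVec x) ^ 2 := by
      rw [hp, Matrix.mulVec_add, Matrix.mulVec_smul, Matrix.mulVec_smul]
      exact norm2_convex_sq _ _ hθ.le h.theta_le_one
    have c2 : σ ^ 2 * norm2 (B.mulVec x) ^ 2 ≤ norm2 x ^ 2 := by
      rw [← mul_pow]
      exact pow_le_pow_left₀ (mul_nonneg h.sigma_pos.le (norm2_nonneg _))
        (h.sigma_inv_transpose x) 2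
    -- ‖x - y‖² ≥ 0 bounds 2(1 - θ)⟨x, y⟩ and leaves -θ‖x‖², which absorbs the θ‖x‖² coming from
    -- `c1` and `c2`.
    have c3 : 0 ≤ norm2 x ^ 2 - 2 * (x ⬝ᵥ y) + norm2 y ^ 2 := by
      have := norm2_sub_smul_sq x y 1
      rw [dotProduct_comm y x] at this
      nlinarith [sq_nonneg (norm2 (x - (1 : ℝ) • y))]
    have c4 := mul_le_mul_of_nonneg_left c1 (sq_nonneg σ)
    rw [hθp, dotProduct_sub, dotProduct_smul, smul_eq_mul, ← norm2_sq_eq_dotProduct, lyap]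
    have c5 := mul_nonneg (sub_nonneg.2 h.theta_le_one) c3
    nlinarith [mul_le_mul_of_nonneg_left c2 hθ.le]
  have : ∑ i, rowProb A lam i * lyap A σ (errStep A lam θ γ i (v, y)) =
      (∑ i, (rowSq A i + lam) * lyap A σ (errStep A lam θ γ i (v, y))) / S := by
    rw [Finset.sum_div]
    refine Finset.sum_congr rfl fun i _ => ?_
    rw [rowProb]
    ring
  rw [this, div_le_iff₀ hSpos]
  calc _ ≤ _ := hsum
    _ ≤ S * ((1 - θ) * lyap A σ (v, y)) := mul_le_mul_of_nonneg_left hfin hSpos.le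
    _ = _ := mul_comm _ _

/-- The square root of the Lyapunov function is a seminorm. -/
noncomputable def lyapNorm (A : Matrix (Fin n) (Fin n) ℝ) (σ : ℝ)
    (s : (Fin n → ℝ) × (Fin n → ℝ)) : ℝ := √(lyap A σ s)

theorem lyap_nonneg (s : (Fin n → ℝ) × (Fin n → ℝ)) : 0 ≤ lyap A σ s := by
  rw [lyap]; positivity

theorem lyapNorm_nonneg (s : (Fin n → ℝ) × (Fin n → ℝ)) : 0 ≤ lyapNorm A σ s := Real.sqrt_nonneg _

theorem lyapNorm_sq (s : (Fin n → ℝ) × (Fin n → ℝ)) : lyapNorm A σ s ^ 2 = lyap A σ s :=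
  Real.sq_sqrt (lyap_nonneg s)

theorem norm2_snd_le_lyapNorm (s : (Fin n → ℝ) × (Fin n → ℝ)) : norm2 s.2 ≤ lyapNorm A σ s := by
  refine Real.le_sqrt_of_sq_le ?_
  rw [lyap]
  have : 0 ≤ σ ^ 2 * norm2 ((A⁻¹).transpose.mulVec s.1) ^ 2 := by positivity
  linarith

/-- The potential sees v only through A⁻ᵀ; undoing this with ‖Aᵀ‖ ≤ ‖A‖_F costs the factor κ. -/
theorem IsParam.norm2_fst_le (h : IsParam A lam σ θ γ) (s : (Fin n → ℝ) × (Fin n → ℝ)) :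
    norm2 s.1 ≤ √(frobSq A) / σ * lyapNorm A σ s := by
  have h1 : σ * norm2 ((A⁻¹).transpose.mulVec s.1) ≤ lyapNorm A σ s := by
    refine Real.le_sqrt_of_sq_le ?_
    rw [lyap, mul_pow]
    linarith [sq_nonneg (norm2 s.2)]
  have h2 : s.1 = A.transpose.mulVec ((A⁻¹).transpose.mulVec s.1) := by
    rw [Matrix.mulVec_mulVec, ← Matrix.transpose_mul, Matrix.nonsing_inv_mul A h.det,
      Matrix.transpose_one, Matrix.one_mulVec]
  calc norm2 s.1 ≤ √(frobSq A) * norm2 ((A⁻¹).transpose.mulVec s.1) := by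
        nth_rewrite 1 [h2]
        rw [← frobSq_transpose A]
        exact norm2_mulVec_le _ _
    _ = √(frobSq A) / σ * (σ * norm2 ((A⁻¹).transpose.mulVec s.1)) := by
        field_simp [h.sigma_pos.ne']
    _ ≤ _ := mul_le_mul_of_nonneg_left h1 (div_nonneg (Real.sqrt_nonneg _) h.sigma_pos.le)

theorem IsParam.lyapNorm_le (h : IsParam A lam σ θ γ) (s : (Fin n → ℝ) × (Fin n → ℝ)) :
    lyapNorm A σ s ≤ norm2 s.1 + norm2 s.2 := by
  refine Real.sqrt_le_iff.2 ⟨add_nonneg (norm2_nonneg _) (norm2_nonneg _), ?_⟩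
  have := pow_le_pow_left₀ (mul_nonneg h.sigma_pos.le (norm2_nonneg _))
    (h.sigma_inv_transpose s.1) 2
  rw [mul_pow] at this
  rw [lyap]
  nlinarith [mul_nonneg (norm2_nonneg s.1) (norm2_nonneg s.2)]

theorem norm2_add_sq_le (v w : Fin n → ℝ) {η : ℝ} (hη : 0 < η) :
    norm2 (v + w) ^ 2 ≤ (1 + η) * norm2 v ^ 2 + (1 + 1 / η) * norm2 w ^ 2 := by
  refine (pow_le_pow_left₀ (norm2_nonneg _) (norm2_add_le v w) 2).trans ?_
  have : 0 ≤ (η * norm2 v - norm2 w) ^ 2 / η := by positivity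
  have e : (η * norm2 v - norm2 w) ^ 2 / η =
      η * norm2 v ^ 2 - 2 * norm2 v * norm2 w + 1 / η * norm2 w ^ 2 := by
    field_simp
    ring
  nlinarith

/-- Young's inequality with a free parameter; the choice η = θ/2 lets a rounding perturbation
consume only part of the contraction. -/
theorem lyap_add_le (s e : (Fin n → ℝ) × (Fin n → ℝ)) {η : ℝ} (hη : 0 < η) :
    lyap A σ (s + e) ≤ (1 + η) * lyap A σ s + (1 + 1 / η) * lyap A σ e := by
  have h1 := mul_le_mul_of_nonneg_left (norm2_add_sq_le ((A⁻¹).transpose.mulVec s.1)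
    ((A⁻¹).transpose.mulVec e.1) hη) (sq_nonneg σ)
  have h2 := norm2_add_sq_le s.2 e.2 hη
  simp only [lyap, Prod.fst_add, Prod.snd_add, Matrix.mulVec_add]
  linarith

end Lyapunov

/-! ### The smallest singular value and the parameters of the method -/

section SmallestSingularValue

variable {n : ℕ} {A : Matrix (Fin n) (Fin n) ℝ}

theorem norm2_eq_norm_toEuclideanLin (A : Matrix (Fin n) (Fin n) ℝ) (x : Fin n → ℝ) :
    norm2 (A.mulVec x) = ‖Matrix.toEuclideanLin A (WithLp.toLp 2 x)‖ := by
  rw [norm2, Matrix.toLpLin_toLp, Matrix.toLin'_apply]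

/-- Diagonalization of AᵀA: ‖Ax‖² = ⟨AᵀAx, x⟩ in an eigenbasis. It yields both the lower bound by
`sigmaMin` and a vector attaining it. -/
theorem norm_sq_eq_sum_eigenvalues (A : Matrix (Fin n) (Fin n) ℝ) (x : EuclideanSpace ℝ (Fin n)) :
    ‖Matrix.toEuclideanLin A x‖ ^ 2 =
      ∑ i, (Matrix.toEuclideanLin A).isSymmetric_adjoint_comp_self.eigenvalues
        (finrank_euclideanSpace_fin) i *
        ((Matrix.toEuclideanLin A).isSymmetric_adjoint_comp_self.eigenvectorBasis
          (finrank_euclideanSpace_fin)).repr x i ^ 2 := by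
  set T := Matrix.toEuclideanLin A
  set b := T.isSymmetric_adjoint_comp_self.eigenvectorBasis
    (finrank_euclideanSpace_fin (𝕜 := ℝ) (n := n))
  have h1 : ‖T x‖ ^ 2 = inner ℝ ((LinearMap.adjoint T ∘ₗ T) x) x := by
    rw [LinearMap.comp_apply, LinearMap.adjoint_inner_left, real_inner_self_eq_norm_sq]
  rw [h1, ← b.repr.inner_map_map, PiLp.inner_apply]
  refine Finset.sum_congr rfl fun i _ => ?_
  rw [T.isSymmetric_adjoint_comp_self.eigenvectorBasis_apply_self_apply]
  simp only [RCLike.inner_apply, conj_trivial, RCLike.ofReal_real_eq_id, id_eq]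
  ring

theorem sigmaMin_mul_norm2_le (A : Matrix (Fin n) (Fin n) ℝ) (x : Fin n → ℝ) :
    sigmaMin A * norm2 x ≤ norm2 (A.mulVec x) := by
  rcases n.eq_zero_or_pos with rfl | hn
  · have h0 : ∀ w : Fin 0 → ℝ, norm2 w = 0 := fun w => by
      rw [Subsingleton.elim w 0, norm2_zero]
    rw [h0, h0, mul_zero]
  refine le_of_sq_le_sq ?_ (norm2_nonneg _)
  rw [norm2_eq_norm_toEuclideanLin, norm_sq_eq_sum_eigenvalues, mul_pow, norm2,
    ← (((Matrix.toEuclideanLin A).isSymmetric_adjoint_comp_self.eigenvectorBasis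
          (finrank_euclideanSpace_fin)).repr).norm_map, EuclideanSpace.real_norm_sq_eq,
    Finset.mul_sum]
  refine Finset.sum_le_sum fun i _ => mul_le_mul_of_nonneg_right ?_ (sq_nonneg _)
  -- Eigenvalues are listed in decreasing order, so the one of index n - 1 is the least.
  rw [sigmaMin, (Matrix.toEuclideanLin A).sq_singularValues_of_lt finrank_euclideanSpace_fin
    (Nat.sub_one_lt hn.ne')]
  refine LinearMap.IsSymmetric.eigenvalues_antitone _ _ ?_
  rw [Fin.le_def]
  exact Nat.le_sub_one_of_lt i.2

theorem exists_norm2_mulVec_eq_sigmaMin (A : Matrix (Fin n) (Fin n) ℝ) (hn : 0 < n) :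
    ∃ x, norm2 x = 1 ∧ norm2 (A.mulVec x) = sigmaMin A := by
  set T := Matrix.toEuclideanLin A
  set b := T.isSymmetric_adjoint_comp_self.eigenvectorBasis
    (finrank_euclideanSpace_fin (𝕜 := ℝ) (n := n))
  set l : Fin n := ⟨n - 1, Nat.sub_one_lt hn.ne'⟩
  refine ⟨(b l).ofLp, b.orthonormal.1 l, ?_⟩
  refine (sq_eq_sq₀ (norm2_nonneg _) (LinearMap.singularValues_nonneg _ _)).1 ?_
  change _ = T.singularValues (n - 1) ^ 2
  rw [T.sq_singularValues_of_lt finrank_euclideanSpace_fin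
    (Nat.sub_one_lt hn.ne'), norm2_eq_norm_toEuclideanLin, norm_sq_eq_sum_eigenvalues,
    Finset.sum_eq_single l]
  · simp [b, l, T]
  · intro j _ hj
    have : b.repr (b l) j = 0 := by
      rw [b.repr_self]
      simp [hj]
    exact mul_eq_zero_of_right _ (pow_eq_zero_iff two_ne_zero |>.2 this)
  · simp

theorem sigmaMin_pos (hn : 0 < n) (hA : IsUnit A.det) : 0 < sigmaMin A := by
  refine lt_of_le_of_ne (LinearMap.singularValues_nonneg _ _) fun h0 => ?_
  obtain ⟨x, hx, hAx⟩ := exists_norm2_mulVec_eq_sigmaMin A hn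
  have h1 : A.mulVec x = 0 := by
    have : norm2 (A.mulVec x) = 0 := hAx.trans h0.symm
    rw [norm2, norm_eq_zero] at this
    exact (WithLp.toLp_injective 2) this
  have h2 : x = A⁻¹.mulVec (A.mulVec x) := by
    rw [Matrix.mulVec_mulVec, Matrix.nonsing_inv_mul A hA, Matrix.one_mulVec]
  rw [h1, Matrix.mulVec_zero] at h2
  rw [h2, norm2_zero] at hx
  exact zero_ne_one hx

theorem sigmaMin_mul_norm2_inv_le (hA : IsUnit A.det) (w : Fin n → ℝ) :
    sigmaMin A * norm2 (A⁻¹.mulVec w) ≤ norm2 w := by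
  have := sigmaMin_mul_norm2_le A (A⁻¹.mulVec w)
  rwa [Matrix.mulVec_mulVec, Matrix.mul_nonsing_inv A hA, Matrix.one_mulVec] at this

theorem demmel_eq (hn : 0 < n) (hA : IsUnit A.det) : demmel A = √(frobSq A) / sigmaMin A := by
  have hσ := sigmaMin_pos hn hA
  have hnorm : ∀ w : Fin n → ℝ,
      norm2 (A⁻¹.mulVec w) = ‖Matrix.toEuclideanCLM (𝕜 := ℝ) A⁻¹ (WithLp.toLp 2 w)‖ := fun w => by
    rw [Matrix.toEuclideanCLM_toLp, norm2]
  have h : ‖Matrix.toEuclideanCLM (𝕜 := ℝ) A⁻¹‖ = 1 / sigmaMin A := by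
    refine le_antisymm (ContinuousLinearMap.opNorm_le_bound _ (by positivity) fun w => ?_) ?_
    · have := sigmaMin_mul_norm2_inv_le hA w.ofLp
      rw [hnorm] at this
      rw [div_mul_eq_mul_div, one_mul, le_div_iff₀ hσ, mul_comm]
      exact this
    · obtain ⟨x, hx, hAx⟩ := exists_norm2_mulVec_eq_sigmaMin A hn
      rw [div_le_iff₀ hσ, ← hAx, ← hx]
      have h2 : x = A⁻¹.mulVec (A.mulVec x) := by
        rw [Matrix.mulVec_mulVec, Matrix.nonsing_inv_mul A hA, Matrix.one_mulVec]
      nth_rewrite 1 [h2]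
      rw [hnorm]
      exact ContinuousLinearMap.le_opNorm _ _
  rw [demmel, h]
  ring

/-- Cauchy–Schwarz in ⟨a_i, A⁻¹e_i⟩ = 1, with ‖A⁻¹e_i‖ ≤ 1/σ. -/
theorem sigmaMin_sq_le_rowSq (hA : IsUnit A.det) (hn : 0 < n) (i : Fin n) :
    sigmaMin A ^ 2 ≤ rowSq A i := by
  have hσ := sigmaMin_pos hn hA
  have h1 : A i ⬝ᵥ A⁻¹.mulVec (Pi.single i 1) = 1 := by
    have := congrFun (congrArg (fun M => M.mulVec (Pi.single i (1 : ℝ)))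
      (Matrix.mul_nonsing_inv A hA)) i
    simp only [← Matrix.mulVec_mulVec, Matrix.one_mulVec, Pi.single_eq_same] at this
    exact this
  have h2 := (le_abs_self _).trans (abs_dotProduct_le (A i) (A⁻¹.mulVec (Pi.single i 1)))
  have h3 := sigmaMin_mul_norm2_inv_le hA (Pi.single i 1)
  have h4 : norm2 (Pi.single i (1 : ℝ)) = 1 := by simp [norm2]
  rw [h1] at h2
  rw [h4] at h3
  have h5 : sigmaMin A ≤ norm2 (A i) := by
    calc sigmaMin A = sigmaMin A * 1 := (mul_one _).symm
      _ ≤ sigmaMin A * (norm2 (A i) * norm2 (A⁻¹.mulVec (Pi.single i 1))) := by gcongr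
      _ = norm2 (A i) * (sigmaMin A * norm2 (A⁻¹.mulVec (Pi.single i 1))) := by ring
      _ ≤ norm2 (A i) * 1 := mul_le_mul_of_nonneg_left h3 (norm2_nonneg _)
      _ = _ := mul_one _
  rw [rowSq_eq]
  exact pow_le_pow_left₀ hσ.le h5 2

/-- For an invertible matrix and an admissible regularization, the parameters of the method have
the properties required by the analysis. -/
theorem exists_isParam {lam : ℝ} (hn : 0 < n) (hA : IsUnit A.det) (hlam : AdmissibleReg A lam) :
    ∃ θ, IsParam A lam (sigmaMin A) θ (gammaP A lam) ∧
      alphaP A lam = θ / (1 + θ) ∧ betaP A lam = 1 - θ := by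
  have : Nonempty (Fin n) := ⟨⟨0, hn⟩⟩
  set σ := sigmaMin A with hσdef
  have hσ : 0 < σ := sigmaMin_pos hn hA
  have hrow := sigmaMin_sq_le_rowSq hA hn
  have hF0 := frobSq_nonneg A
  set R := frobSq A with hR
  have hn1 : (1 : ℝ) ≤ n := by exact_mod_cast hn
  obtain ⟨i₀, hi₀⟩ := exists_eq_ciInf_of_finite (f := rowSq A)
  have hmin : ∀ i, rowSq A i₀ ≤ rowSq A i := fun i => by
    rw [hi₀]; exact ciInf_le (Set.finite_range _).bddBelow i
  have hrowF : ∀ i, rowSq A i ≤ R := fun i => by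
    rw [hR, frobSq_eq]
    exact Finset.single_le_sum (fun j _ => rowSq_nonneg A j) (Finset.mem_univ i)
  have hlam0 : 0 ≤ lam := by
    rcases hlam with h | h
    · rw [h]; positivity
    · exact h.1.ge
  have hlamR : lam ≤ R := by
    rcases hlam with h | h
    · rw [h]; exact div_le_self hF0 hn1
    · rw [h.1]; exact hF0
  set m := rowSq A i₀ + lam with hm
  set S := R + n * lam with hS
  have hσ2 : σ ^ 2 ≤ R := (hrow i₀).trans (hrowF i₀)
  have hm0 : 0 < m := by
    have := hrow i₀
    have : 0 < σ ^ 2 := by positivity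
    linarith [hrow i₀]
  have hRpos : 0 < R := lt_of_lt_of_le (by positivity) hσ2
  have hSR : R ≤ S := by
    have : 0 ≤ n * lam := by positivity
    linarith
  have hSpos : 0 < S := hRpos.trans_le hSR
  have hmS : m ≤ S := by
    have : lam ≤ n * lam := le_mul_of_one_le_left hlam0 hn1
    linarith [hrowF i₀]
  -- This is the lower bound θ ≥ σ/(2√n ‖A‖_F) in disguise. For λ = R/n one has S = 2R and R ≤ nm;
  -- for balanced rows S = R ≤ 4nm.
  have hSm : S ^ 2 ≤ 4 * n * R * m := by
    rcases hlam with h | ⟨h, hb⟩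
    · have h1 : n * lam = R := by rw [h, ← hR]; field_simp
      have h2 : R ≤ n * m := by
        have : 0 ≤ n * rowSq A i₀ := mul_nonneg (by positivity) (rowSq_nonneg A i₀)
        rw [hm]; linarith
      rw [hS, h1]
      nlinarith
    · have h1 : R ≤ n * (4 * m) := by
        rw [hR, frobSq_eq]
        refine (Finset.sum_le_sum fun i _ => hb i i₀).trans_eq ?_
        simp [hm, h]
      rw [hS, h, mul_zero, add_zero]
      nlinarith
  have hmu : muT A lam = σ ^ 2 / S := rfl
  have hnu : nuT A lam = S / m := by rw [nuT, ← hi₀]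
  have hsm : 0 < √m := Real.sqrt_pos.2 hm0
  have hsm2 : √m ^ 2 = m := Real.sq_sqrt hm0.le
  have hsR : 0 < √R := Real.sqrt_pos.2 hRpos
  have hsR2 : √R ^ 2 = R := Real.sq_sqrt hRpos.le
  have hθ : √(muT A lam / nuT A lam) = √m * σ / S := by
    rw [hmu, hnu, show σ ^ 2 / S / (S / m) = (√m * σ / S) ^ 2 by
      rw [div_pow, mul_pow, hsm2]; field_simp]
    exact Real.sqrt_sq (by positivity)
  have hγ : gammaP A lam = √m / σ := by
    rw [gammaP, hmu, hnu, show σ ^ 2 / S * (S / m) = (σ / √m) ^ 2 by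
      rw [div_pow, hsm2]; field_simp, Real.sqrt_sq (by positivity), one_div_div]
  have hγ0 : 0 < gammaP A lam := by rw [hγ]; positivity
  have hmm : m * R ≤ S ^ 2 := by nlinarith
  refine ⟨√m * σ / S, ⟨hA, hlam0, hσ, sigmaMin_mul_norm2_inv_le hA, ?_, by positivity, ?_, hγ0,
    ?_, ?_, ?_, ?_, ?_⟩, ?_, ?_⟩
  · exact Real.le_sqrt_of_sq_le hσ2
  · rw [div_le_one hSpos]
    refine le_of_sq_le_sq ?_ hSpos.le
    rw [mul_pow, hsm2]
    nlinarith
  · intro i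
    rw [hγ, div_pow, hsm2, div_mul_cancel₀ _ (by positivity)]
    linarith [hmin i]
  · rw [hγ]
    field_simp
    rfl
  · rw [div_mul_eq_mul_div, div_le_iff₀ hSpos, mul_right_comm, mul_comm σ]
    refine mul_le_mul_of_nonneg_right ?_ hσ.le
    refine le_of_sq_le_sq ?_ hSpos.le
    rw [mul_pow, hsm2, hsR2]
    exact hmm
  · rw [hγ, div_mul_cancel₀ _ hσ.ne']
    refine le_of_sq_le_sq ?_ (by positivity)
    rw [mul_pow, hsm2, hsR2]
    linarith [hrowF i₀]
  · rw [← mul_div_assoc, le_div_iff₀ hSpos, ← mul_assoc, mul_comm σ]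
    refine mul_le_mul_of_nonneg_right ?_ hσ.le
    refine le_of_sq_le_sq ?_ (by positivity)
    rw [mul_pow, mul_pow, mul_pow, hsm2, hsR2, Real.sq_sqrt (by positivity)]
    linarith
  · rw [alphaP, hγ, hnu]
    have : √m / σ * (S / m) = S / (√m * σ) := by
      nth_rewrite 2 [← hsm2]
      field_simp
    rw [this]
    field_simp
    ring
  · rw [betaP, hθ]

end SmallestSingularValue

/-! ### Rounding errors of one iteration -/

section Rounding

variable {n : ℕ} {A : Matrix (Fin n) (Fin n) ℝ} {lam σ θ u : ℝ} {F : FloatArith u}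

open FloatArith

theorem approx_flMat_row (A : Matrix (Fin n) (Fin n) ℝ) (i : Fin n) {ε : ℝ} (h : u ≤ ε)
    (hu : 0 ≤ u) : F.Approx ε (F.flMat A i) (A i) (norm2 (A i)) :=
  approx_flVec (v := A i) h le_rfl hu

/-- The unit in which rounding errors of a single operation or inner product are measured. -/
noncomputable def roundUnit (n : ℕ) (u : ℝ) : ℝ := 4 * ((n + 2) * u)

theorem le_roundUnit (n : ℕ) (hu : 0 ≤ u) : u ≤ roundUnit n u := by
  have : (0 : ℝ) ≤ n * u := by positivity
  rw [roundUnit]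
  nlinarith

theorem IsParam.alpha_nonneg (h : IsParam A lam σ θ (gammaP A lam)) : 0 ≤ θ / (1 + θ) := by
  have := h.theta_pos
  positivity

theorem IsParam.alpha_le (h : IsParam A lam σ θ (gammaP A lam)) : θ / (1 + θ) ≤ θ :=
  div_le_self h.theta_pos.le (by linarith [h.theta_pos])

theorem IsParam.alpha_le_one (h : IsParam A lam σ θ (gammaP A lam)) : θ / (1 + θ) ≤ 1 :=
  h.alpha_le.trans h.theta_le_one

theorem approx_arkX (h : IsParam A lam σ θ (gammaP A lam)) (hα : alphaP A lam = θ / (1 + θ))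
    (hu : 0 ≤ u) (hsmall : 8 ^ 2 * roundUnit n u ≤ 1) {v y : Fin n → ℝ} {V Y : ℝ}
    (hv : ∀ j, F.fl (v j) = v j) (hy : ∀ j, F.fl (y j) = y j) (hV : norm2 v ≤ V)
    (hY : norm2 y ≤ Y) :
    F.Approx (8 ^ 3 * roundUnit n u) (arkX F A lam v y)
      ((θ / (1 + θ)) • v + (1 - θ / (1 + θ)) • y) (θ / (1 + θ) * V + 2 * Y) := by
  have hε := le_roundUnit n hu
  set ε := roundUnit n u
  have hε0 : 0 ≤ ε := hu.trans hε
  have a0 := h.alpha_nonneg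
  have a1 := h.alpha_le_one
  have s1 : F.ApproxScalar ε (F.fl (alphaP A lam)) (θ / (1 + θ)) (θ / (1 + θ)) := by
    rw [hα]
    exact approxScalar_fl hε (abs_of_nonneg a0).le hu
  have s2 : F.ApproxScalar ε (F.fl 1) 1 1 := approxScalar_fl hε (by simp) hu
  have s3 := (s2.sub hu hε (by linarith) s1).mono (by positivity) le_rfl
    (show 1 + θ / (1 + θ) ≤ 2 by linarith)
  have t1 := (s1.mono hε0 (show ε ≤ 8 * ε by linarith) le_rfl).smul hu (by linarith)
    (by linarith) (approx_self (F := F) hv (by positivity) hV)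
  have t2 := s3.smul hu (by linarith) (by linarith) (approx_self (F := F) hy (by positivity) hY)
  have t3 := t1.vadd hu (by linarith) (by linarith) t2
  exact t3.mono (by positivity) (by linarith) le_rfl

/-- The computed numerator has error relative to ‖a_i‖(X + Z). Division by ‖a_i‖² + λ and
multiplication by a_i bring a factor ‖a_i‖²/(‖a_i‖² + λ) ≤ 1, so neither small rows nor the
conditioning of A enter. -/
theorem approx_arkW (h : IsParam A lam σ θ (gammaP A lam))
    (hu : 0 ≤ u) (hsmall : 8 ^ 6 * roundUnit n u ≤ 1) {x' x z c : Fin n → ℝ} {X Z : ℝ}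
    (hx : F.Approx (8 ^ 3 * roundUnit n u) x' x X) (hc : ∀ j, F.fl (c j) = c j)
    (hz : c = A.mulVec z) (hZ : norm2 z ≤ Z) (i : Fin n) :
    F.Approx (8 ^ 7 * roundUnit n u) (arkW F A lam c i x')
      (((A i ⬝ᵥ (x - z)) / (rowSq A i + lam)) • A i) (X + Z) := by
  have hε := le_roundUnit n hu
  have hεdef : 4 * ((n + 2) * u) = roundUnit n u := rfl
  set ε := roundUnit n u
  have hε0 : 0 ≤ ε := hu.trans hε
  have hq := h.weight_pos i
  have hX := hx.bound_nonneg
  have hZ0 := (norm2_nonneg z).trans hZ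
  have ha := norm2_nonneg (A i)
  have s1 := (approx_flMat_row (F := F) A i (show u ≤ 8 ^ 3 * ε by linarith) hu).dot hu
    (by linarith) (by linarith) hx
  have s2 : F.ApproxScalar (8 * (8 ^ 3 * ε)) (c i) (A i ⬝ᵥ z) (norm2 (A i) * Z) := by
    have : c i = A i ⬝ᵥ z := by rw [hz]; rfl
    rw [← this]
    refine approxScalar_self (hc i) (by positivity) ?_
    rw [this]
    exact (abs_dotProduct_le _ _).trans (mul_le_mul_of_nonneg_left hZ ha)
  have s3 := s1.sub hu (by linarith) (by linarith) s2
  rw [← dotProduct_sub, ← mul_add] at s3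
  have d1 := (approx_flMat_row (F := F) A i hε hu).dot hu hεdef.le (by linarith)
    (approx_flMat_row (F := F) A i hε hu)
  have d2 : F.ApproxScalar (8 * ε) (F.fl lam) lam lam :=
    approxScalar_fl (by linarith) (abs_of_nonneg h.lam_nonneg).le hu
  have d3 := d1.add hu (by linarith) (by linarith) d2
  rw [← norm2_sq_eq_dotProduct, ← sq, ← rowSq_eq] at d3
  have w1 := s3.div hu (by linarith) (by linarith) hq
    (d3.mono (by positivity) (show _ ≤ 8 * (8 * (8 ^ 3 * ε)) by linarith) le_rfl)
  have w2 := w1.smul hu (by linarith) (by linarith)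
    (approx_flMat_row (F := F) A i (by linarith) hu)
  refine w2.mono (by positivity) (by linarith) ?_
  rw [div_mul_eq_mul_div, div_le_iff₀ hq, mul_right_comm, ← sq, ← rowSq_eq, mul_comm]
  exact mul_le_mul_of_nonneg_left (by linarith [h.lam_nonneg]) (by linarith)

/-- The error of the pair `s` as an approximation of the solution `z`. -/
def errPair (z : Fin n → ℝ) (s : (Fin n → ℝ) × (Fin n → ℝ)) : (Fin n → ℝ) × (Fin n → ℝ) :=
  (s.1 - z, s.2 - z)

/-- Both vectors of a pair consist of floating-point numbers. -/
def IsFloatPair (F : FloatArith u) (s : (Fin n → ℝ) × (Fin n → ℝ)) : Prop :=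
  (∀ j, F.fl (s.1 j) = s.1 j) ∧ ∀ j, F.fl (s.2 j) = s.2 j

theorem IsParam.one_le_cond (h : IsParam A lam σ θ (gammaP A lam)) : 1 ≤ √(frobSq A) / σ :=
  (one_le_div h.sigma_pos).2 h.sigma_le

theorem IsParam.theta_cond (h : IsParam A lam σ θ (gammaP A lam)) :
    θ * (√(frobSq A) / σ) ≤ 1 := by
  rw [← mul_div_assoc, div_le_one h.sigma_pos]
  exact h.theta_frob

theorem IsParam.norm2_fst_le_cond (h : IsParam A lam σ θ (gammaP A lam)) (z : Fin n → ℝ)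
    (s : (Fin n → ℝ) × (Fin n → ℝ)) : norm2 s.1 ≤
      √(frobSq A) / σ * (lyapNorm A σ (errPair z s) + norm2 z) := by
  have h1 := norm2_le_norm2_add s.1 z
  have h2 := h.norm2_fst_le (errPair z s)
  have h3 := le_mul_of_one_le_left (norm2_nonneg z) h.one_le_cond
  have h4 : (errPair z s).1 = s.1 - z := rfl
  rw [h4] at h2
  rw [mul_add]
  linarith

theorem norm2_snd_le_add (z : Fin n → ℝ) (s : (Fin n → ℝ) × (Fin n → ℝ)) :
    norm2 s.2 ≤ lyapNorm A σ (errPair z s) + norm2 z := by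
  have h1 := norm2_le_norm2_add s.2 z
  have h2 := norm2_snd_le_lyapNorm (A := A) (σ := σ) (errPair z s)
  have h4 : (errPair z s).2 = s.2 - z := rfl
  rw [h4] at h2
  linarith

/-- The bound on v carries a factor κ, but v has weight θ/(1 + θ) ≤ θ ≤ 1/κ in x. Hence x is bounded
without κ, and the later factor γ ≤ 2κ is the only one in γw. -/
theorem approx_arkX_of_pair (h : IsParam A lam σ θ (gammaP A lam))
    (hα : alphaP A lam = θ / (1 + θ)) (hu : 0 ≤ u) (hsmall : 8 ^ 2 * roundUnit n u ≤ 1)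
    (z : Fin n → ℝ) {s : (Fin n → ℝ) × (Fin n → ℝ)} (hs : IsFloatPair F s) :
    F.Approx (8 ^ 3 * roundUnit n u) (arkX F A lam s.1 s.2)
      ((θ / (1 + θ)) • s.1 + (1 - θ / (1 + θ)) • s.2)
      (3 * (lyapNorm A σ (errPair z s) + norm2 z)) := by
  have h1 := approx_arkX h hα hu hsmall hs.1 hs.2 (h.norm2_fst_le_cond z s)
    (norm2_snd_le_add (A := A) (σ := σ) z s)
  have hε0 := hu.trans (le_roundUnit n hu)
  set T := lyapNorm A σ (errPair z s) + norm2 z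
  have hT : 0 ≤ T := add_nonneg (lyapNorm_nonneg _) (norm2_nonneg _)
  refine h1.mono (by positivity) le_rfl ?_
  have h2 : θ / (1 + θ) * (√(frobSq A) / σ) ≤ 1 :=
    (mul_le_mul_of_nonneg_right h.alpha_le (zero_le_one.trans h.one_le_cond)).trans h.theta_cond
  have := mul_le_mul_of_nonneg_right h2 hT
  rw [mul_assoc] at this
  linarith

/-- A computed iteration differs from an exact one by at most a multiple of
`κ u (‖error‖ + ‖solution‖)`. -/
theorem arkStep_error (h : IsParam A lam σ θ (gammaP A lam)) (hα : alphaP A lam = θ / (1 + θ))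
    (hβ : betaP A lam = 1 - θ) (hu : 0 ≤ u) (hsmall : 8 ^ 9 * roundUnit n u ≤ 1)
    {z c : Fin n → ℝ} (hc : ∀ j, F.fl (c j) = c j) (hz : c = A.mulVec z) (i : Fin n)
    {s : (Fin n → ℝ) × (Fin n → ℝ)} (hs : IsFloatPair F s) :
    IsFloatPair F (arkStep F A lam c i s) ∧
      lyapNorm A σ (errPair z (arkStep F A lam c i s)
          - errStep A lam θ (gammaP A lam) i (errPair z s)) ≤
        8 ^ 9 * roundUnit n u * (22 * (√(frobSq A) / σ)) *
          (lyapNorm A σ (errPair z s) + norm2 z) := by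
  have hε := le_roundUnit n hu
  have hε0 := hu.trans hε
  have hxa := approx_arkX_of_pair h hα hu (by linarith) z hs
  have hV := h.norm2_fst_le_cond z s
  have hκ := h.one_le_cond
  have hγ := h.gamma_pos
  have hγκ : gammaP A lam ≤ 2 * (√(frobSq A) / σ) := by
    rw [← mul_div_assoc, le_div_iff₀ h.sigma_pos]; exact h.gamma_le
  have hθ := h.theta_pos
  have hθ1 := h.theta_le_one
  set ε := roundUnit n u
  set κ := √(frobSq A) / σ
  set γ := gammaP A lam
  set T := lyapNorm A σ (errPair z s) + norm2 z with hTdef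
  have hT : 0 ≤ T := add_nonneg (lyapNorm_nonneg _) (norm2_nonneg _)
  have hzT : norm2 z ≤ T := le_add_of_nonneg_left (lyapNorm_nonneg _)
  set x' := arkX F A lam s.1 s.2 with hx'
  set x : Fin n → ℝ := (θ / (1 + θ)) • s.1 + (1 - θ / (1 + θ)) • s.2 with hx
  have hwa := approx_arkW h hu (by linarith) hxa hc hz hzT i
  set w' := arkW F A lam c i x' with hw'
  set w := ((A i ⬝ᵥ (x - z)) / (rowSq A i + lam)) • A i with hw
  have hy := (hxa.mono (by positivity) (show _ ≤ 8 ^ 7 * ε by linarith) le_rfl).vsub hu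
    (by linarith) (by linarith) hwa
  have b1 : F.ApproxScalar (8 ^ 2 * ε) (F.fl (betaP A lam)) (1 - θ) 1 := by
    rw [hβ]
    exact approxScalar_fl (by linarith) (abs_le.2 ⟨by linarith, by linarith⟩) hu
  have b2 : F.ApproxScalar (8 ^ 2 * ε) (F.fl 1) 1 1 := approxScalar_fl (by linarith) (by simp) hu
  have b3 := b2.sub hu (by linarith) (by linarith) b1
  rw [sub_sub_cancel] at b3
  have v1 := (b1.mono (by positivity) (show _ ≤ 8 ^ 3 * ε by linarith) le_rfl).smul hu
    (by linarith) (by linarith) (approx_self (F := F) hs.1 (by positivity) hV)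
  have v2 := (b3.mono (by positivity) (show _ ≤ 8 ^ 3 * ε by linarith) le_rfl).smul hu
    (by linarith) (by linarith) hxa
  have v3 := v1.vadd hu (by linarith) (by linarith) v2
  have g1 : F.ApproxScalar (8 ^ 7 * ε) (F.fl γ) γ γ :=
    approxScalar_fl (by linarith) (abs_of_pos hγ).le hu
  have v4 := g1.smul hu (by linarith) (by linarith) hwa
  have v5 := (v3.mono (by positivity) (show _ ≤ 8 * (8 ^ 7 * ε) by linarith) le_rfl).vsub hu
    (by linarith) (by linarith) v4
  refine ⟨⟨v5.1, hy.1⟩, (h.lyapNorm_le _).trans ?_⟩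
  have hxz : (θ / (1 + θ)) • (s.1 - z) + (1 - θ / (1 + θ)) • (s.2 - z) = x - z := by
    rw [hx]; module
  have e1 : (errPair z (arkStep F A lam c i s) - errStep A lam θ γ i (errPair z s)).1 =
      F.vsub (F.vadd (F.smul (F.fl (betaP A lam)) s.1)
        (F.smul (F.sub (F.fl 1) (F.fl (betaP A lam))) x')) (F.smul (F.fl γ) w')
        - ((1 - θ) • s.1 + θ • x - γ • w) := by
    simp only [errPair, errStep, hxz, Prod.fst_sub]
    change F.vsub (F.vadd (F.smul (F.fl (betaP A lam)) s.1)
        (F.smul (F.sub (F.fl 1) (F.fl (betaP A lam))) x')) (F.smul (F.fl γ) w') - z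
        - ((1 - θ) • (s.1 - z) + θ • (x - z) - γ • w) = _
    module
  have e2 : (errPair z (arkStep F A lam c i s) - errStep A lam θ γ i (errPair z s)).2 =
      F.vsub x' w' - (x - w) := by
    simp only [errPair, errStep, hxz, Prod.snd_sub]
    change F.vsub x' w' - z - (x - z - w) = _
    module
  rw [e1, e2]
  have k1 := v5.2.2
  have k2 := hy.2.2
  -- The sizes in the v- and y-updates, with γ ≤ 2κ and κ ≥ 1; 15 + 7 gives the constant 22.
  have k3 : 1 * (κ * T) + (1 + 1) * (3 * T) + γ * (3 * T + T) ≤ 15 * (κ * T) := by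
    have := mul_le_mul_of_nonneg_right hκ hT
    have := mul_le_mul_of_nonneg_right hγκ hT
    linarith
  have k4 : 3 * T + (3 * T + T) ≤ 7 * (κ * T) := by
    have := mul_le_mul_of_nonneg_right hκ hT
    linarith
  have k5 := mul_le_mul_of_nonneg_left k3 (show 0 ≤ 8 ^ 9 * ε by positivity)
  have k6 := mul_le_mul_of_nonneg_left k4 (show 0 ≤ 8 ^ 9 * ε by positivity)
  have k7 : (0 : ℝ) ≤ 8 ^ 7 * ε * (3 * T + (3 * T + T)) := by positivity
  linarith

theorem IsParam.sum_rowProb (h : IsParam A lam σ θ (gammaP A lam)) (hn : 0 < n) :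
    ∑ i, rowProb A lam i = 1 := by
  have : Nonempty (Fin n) := ⟨⟨0, hn⟩⟩
  simp only [rowProb]
  rw [← Finset.sum_div]
  exact div_self (Finset.sum_pos (fun i _ => h.weight_pos i) Finset.univ_nonempty).ne'

theorem IsParam.rowProb_nonneg (h : IsParam A lam σ θ (gammaP A lam)) (i : Fin n) :
    0 ≤ rowProb A lam i :=
  div_nonneg (h.weight_pos i).le (Finset.sum_nonneg fun j _ => (h.weight_pos j).le)

/-- One computed iteration contracts the expected Lyapunov function up to a small multiple of the
squared norm of the solution. -/
theorem sum_lyap_arkStep_le (h : IsParam A lam σ θ (gammaP A lam))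
    (hα : alphaP A lam = θ / (1 + θ)) (hβ : betaP A lam = 1 - θ) (hn : 0 < n) (hu : 0 ≤ u)
    (hsmall : 8 ^ 9 * roundUnit n u * (22 * (√(frobSq A) / σ)) ≤ θ / 100)
    {z c : Fin n → ℝ} (hc : ∀ j, F.fl (c j) = c j) (hz : c = A.mulVec z)
    {s : (Fin n → ℝ) × (Fin n → ℝ)} (hs : IsFloatPair F s) :
    ∑ i, rowProb A lam i * lyap A σ (errPair z (arkStep F A lam c i s)) ≤
      (1 - θ / 4) * lyap A σ (errPair z s) + θ / 1000 * norm2 z ^ 2 := by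
  have hθ := h.theta_pos
  have hθ1 := h.theta_le_one
  have hκ := h.one_le_cond
  have hε0 : 0 ≤ 8 ^ 9 * roundUnit n u :=
    mul_nonneg (by norm_num) (hu.trans (le_roundUnit n hu))
  have hsmall' : 8 ^ 9 * roundUnit n u ≤ 1 := by nlinarith
  set δ := 8 ^ 9 * roundUnit n u * (22 * (√(frobSq A) / σ)) with hδ
  have hδ0 : 0 ≤ δ := mul_nonneg hε0 (by linarith)
  set L := lyap A σ (errPair z s) with hL
  have hL0 : 0 ≤ L := lyap_nonneg _
  -- Young's inequality multiplies the squared rounding error by at most 3/θ; that error is of order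
  -- (θ/100)², so a term of order θ remains.
  have hrow : ∀ i, lyap A σ (errPair z (arkStep F A lam c i s)) ≤
      (1 + θ / 2) * lyap A σ (errStep A lam θ (gammaP A lam) i (errPair z s)) +
        θ / 1500 * (L + norm2 z ^ 2) := by
    intro i
    have h1 := (arkStep_error h hα hβ hu hsmall' hc hz i hs).2
    have h2 := lyap_add_le (A := A) (σ := σ)
      (errStep A lam θ (gammaP A lam) i (errPair z s))
      (errPair z (arkStep F A lam c i s) - errStep A lam θ (gammaP A lam) i (errPair z s))
      (half_pos hθ)
    rw [add_sub_cancel] at h2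
    set e := errPair z (arkStep F A lam c i s) - errStep A lam θ (gammaP A lam) i (errPair z s)
    have h3 : lyap A σ e ≤ (θ / 100) ^ 2 * (2 * (L + norm2 z ^ 2)) := by
      rw [← lyapNorm_sq, hL, ← lyapNorm_sq]
      set N := lyapNorm A σ (errPair z s)
      have hN : 0 ≤ N := lyapNorm_nonneg _
      have hz0 := norm2_nonneg z
      calc lyapNorm A σ e ^ 2 ≤ (θ / 100 * (N + norm2 z)) ^ 2 :=
            pow_le_pow_left₀ (lyapNorm_nonneg _)
              (h1.trans (mul_le_mul_of_nonneg_right hsmall (by positivity))) 2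
        _ = (θ / 100) ^ 2 * (N + norm2 z) ^ 2 := by ring
        _ ≤ _ := by
          refine mul_le_mul_of_nonneg_left ?_ (sq_nonneg _)
          nlinarith [sq_nonneg (N - norm2 z)]
    have h4 : 1 + 1 / (θ / 2) ≤ 3 / θ := by
      rw [one_div_div, le_div_iff₀ hθ, add_mul, div_mul_cancel₀ _ hθ.ne']
      linarith
    have h5 : (1 + 1 / (θ / 2)) * lyap A σ e ≤
        3 / θ * ((θ / 100) ^ 2 * (2 * (L + norm2 z ^ 2))) :=
      mul_le_mul h4 h3 (lyap_nonneg _) (by positivity)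
    have h6 : 3 / θ * ((θ / 100) ^ 2 * (2 * (L + norm2 z ^ 2))) =
        θ * (6 / 10000) * (L + norm2 z ^ 2) := by
      field_simp
      ring
    have h7 : 0 ≤ θ * (L + norm2 z ^ 2) := by positivity
    linarith
  have hsum : ∑ i, rowProb A lam i * lyap A σ (errPair z (arkStep F A lam c i s)) ≤
      (1 + θ / 2) * ((1 - θ) * L) + θ / 1500 * (L + norm2 z ^ 2) := by
    refine (Finset.sum_le_sum fun i _ =>
      mul_le_mul_of_nonneg_left (hrow i) (h.rowProb_nonneg i)).trans ?_
    simp only [mul_add, Finset.sum_add_distrib]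
    have := mul_le_mul_of_nonneg_left (h.sum_lyap_errStep_le (errPair z s))
      (show 0 ≤ 1 + θ / 2 by positivity)
    rw [Finset.mul_sum] at this
    rw [← Finset.sum_mul, ← Finset.sum_mul, h.sum_rowProb hn, one_mul, one_mul]
    refine add_le_add ((Finset.sum_le_sum fun i _ => ?_).trans this) (by linarith)
    rw [mul_left_comm]
  -- (1 + θ/2)(1 - θ) ≤ 1 - θ/2, and the spare θ/4 absorbs θ/1500.
  refine hsum.trans ?_
  have : 0 ≤ θ * L := by positivity
  have : 0 ≤ θ * norm2 z ^ 2 := by positivity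
  nlinarith [mul_nonneg (mul_nonneg hθ.le hθ.le) hL0]

end Rounding

/-! ### Expectations over finitely many independent draws -/

section Probability

variable {Ω : Type*} [MeasurableSpace Ω] {P : Measure Ω} [IsProbabilityMeasure P]

/-- Rounding functions are arbitrary and need not be measurable. Finiteness of the value spaces
makes every `g` measurable and integrable, so Fubini applies to it. -/
theorem integral_comp_of_indepFun {α β : Type*} [Finite α] [Finite β] [MeasurableSpace α]
    [MeasurableSpace β] [MeasurableSingletonClass α] [MeasurableSingletonClass β] {X : Ω → α}
    {Y : Ω → β} (hX : Measurable X) (hY : Measurable Y) (h : IndepFun X Y P) (g : α → β → ℝ) :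
    ∫ ω, g (X ω) (Y ω) ∂P = ∫ ω, ∫ ω', g (X ω) (Y ω') ∂P ∂P := by
  have : IsProbabilityMeasure (P.map X) := Measure.isProbabilityMeasure_map hX.aemeasurable
  have : IsProbabilityMeasure (P.map Y) := Measure.isProbabilityMeasure_map hY.aemeasurable
  have h1 : ∫ ω, g (X ω) (Y ω) ∂P = ∫ p, g p.1 p.2 ∂(P.map fun ω => (X ω, Y ω)) :=
    (integral_map (φ := fun ω => (X ω, Y ω)) (f := fun p : α × β => g p.1 p.2)
      (hX.prodMk hY).aemeasurable (measurable_of_countable _).aestronglyMeasurable).symm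
  rw [h1, (indepFun_iff_map_prod_eq_prod_map_map hX.aemeasurable hY.aemeasurable).1 h,
    integral_prod _ Integrable.of_finite,
    integral_map hX.aemeasurable (measurable_of_countable _).aestronglyMeasurable]
  refine integral_congr_ae (Filter.Eventually.of_forall fun ω => ?_)
  exact integral_map hY.aemeasurable (measurable_of_countable _).aestronglyMeasurable

theorem integral_comp_eq_sum {n : ℕ} {X : Ω → Fin n} (hX : Measurable X) {p : Fin n → ℝ}
    (hp : ∀ i, 0 ≤ p i) (h : ∀ i, P {ω | X ω = i} = ENNReal.ofReal (p i)) (g : Fin n → ℝ) :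
    ∫ ω, g (X ω) ∂P = ∑ i, p i * g i := by
  have : IsProbabilityMeasure (P.map X) := Measure.isProbabilityMeasure_map hX.aemeasurable
  rw [← integral_map hX.aemeasurable (measurable_of_countable g).aestronglyMeasurable,
    integral_fintype Integrable.of_finite]
  refine Finset.sum_congr rfl fun i _ => ?_
  rw [Measure.real, Measure.map_apply hX (measurableSet_singleton i), smul_eq_mul]
  have : X ⁻¹' {i} = {ω | X ω = i} := rfl
  rw [this, h, ENNReal.toReal_ofReal (hp i)]

/-- Turns a function of all draws that depends only on those in `S` into a function on the finite
space `S → α`. -/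
theorem exists_extend {ι α : Type*} [Nonempty α] (S : Finset ι) :
    ∃ f : (S → α) → ι → α, ∀ x (i : S), f x i = x i := by
  classical
  exact ⟨fun x i => if h : i ∈ S then x ⟨i, h⟩ else Classical.arbitrary α, fun x i => by simp⟩

variable {ι α : Type*} [Finite α] [MeasurableSpace α] [MeasurableSingletonClass α]
  {r : ι → Ω → α}

/-- A function of finitely many of the variables `r i` is integrable. -/
theorem integrable_of_finset (hr : ∀ i, Measurable (r i)) (S : Finset ι) (g : (ι → α) → ℝ)
    (hg : ∀ x y, (∀ i ∈ S, x i = y i) → g x = g y) : Integrable (fun ω => g fun i => r i ω) P := by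
  obtain ⟨ω₀⟩ := P.nonempty_of_neZero
  by_cases hα : Nonempty α
  · obtain ⟨f, hf⟩ := exists_extend (α := α) S
    have hX : Measurable fun ω (i : S) => r i ω := measurable_pi_lambda _ fun i => hr i
    have : IsProbabilityMeasure (P.map fun ω (i : S) => r i ω) :=
      Measure.isProbabilityMeasure_map hX.aemeasurable
    have h1 : Integrable (fun x => g (f x)) (P.map fun ω (i : S) => r i ω) := Integrable.of_finite
    refine (h1.comp_measurable hX).congr (Filter.Eventually.of_forall fun ω => ?_)
    exact hg _ _ fun i hi => hf _ ⟨i, hi⟩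
  · have : IsEmpty α := not_nonempty_iff.1 hα
    have : IsEmpty ι := ⟨fun i => isEmptyElim (r i ω₀)⟩
    have : (fun ω => g fun i => r i ω) = fun _ => g isEmptyElim := by
      ext ω; congr 1; ext i; exact isEmptyElim i
    rw [this]
    exact integrable_const _

/-- Two disjoint finite groups of independent variables can be integrated separately. -/
theorem integral_of_disjoint (hr : ∀ i, Measurable (r i)) (hind : iIndepFun r P) {S T : Finset ι}
    (hST : Disjoint S T) [Nonempty α] (g : (ι → α) → (ι → α) → ℝ)
    (hg : ∀ x x' y y', (∀ i ∈ S, x i = x' i) → (∀ i ∈ T, y i = y' i) → g x y = g x' y') :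
    ∫ ω, g (fun i => r i ω) (fun i => r i ω) ∂P =
      ∫ ω, ∫ ω', g (fun i => r i ω) (fun i => r i ω') ∂P ∂P := by
  obtain ⟨f, hf⟩ := exists_extend (α := α) S
  obtain ⟨f', hf'⟩ := exists_extend (α := α) T
  have key : ∀ ω ω', g (fun i => r i ω) (fun i => r i ω') =
      g (f fun i => r i ω) (f' fun i => r i ω') := fun ω ω' =>
    hg _ _ _ _ (fun i hi => (hf (fun i : S => r i ω) ⟨i, hi⟩).symm)
      fun i hi => (hf' (fun i : T => r i ω') ⟨i, hi⟩).symm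
  simp only [key]
  exact integral_comp_of_indepFun (measurable_pi_lambda _ fun i : S => hr i)
    (measurable_pi_lambda _ fun i : T => hr i) (hind.indepFun_finset S T hST hr)
    (fun x y => g (f x) (f' y))

theorem sq_integral_le {f : Ω → ℝ} (hf : Integrable f P) (hf2 : Integrable (fun ω => f ω ^ 2) P) :
    (∫ ω, f ω ∂P) ^ 2 ≤ ∫ ω, f ω ^ 2 ∂P := by
  set m := ∫ ω, f ω ∂P with hm
  have h0 : 0 ≤ ∫ ω, (f ω - m) ^ 2 ∂P := integral_nonneg fun ω => sq_nonneg _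
  have h1 : ∫ ω, (f ω - m) ^ 2 ∂P = ∫ ω, (f ω ^ 2 - 2 * m * f ω + m ^ 2) ∂P := by
    congr 1; ext ω; ring
  have h2 : Integrable (fun ω => f ω ^ 2 - 2 * m * f ω) P := hf2.sub (hf.const_mul _)
  rw [h1, integral_add h2 (integrable_const _),
    integral_sub hf2 (hf.const_mul _), integral_const_mul, ← hm] at h0
  simp only [integral_const, probReal_univ, smul_eq_mul, one_mul] at h0
  nlinarith

end Probability

/-! ### Expected error of a single solve -/

section Solve

variable {n : ℕ} {A : Matrix (Fin n) (Fin n) ℝ} {lam σ θ u : ℝ} {F : FloatArith u}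

theorem arkState_congr (c : Fin n → ℝ) {r r' : ℕ → Fin n} :
    ∀ k, (∀ j < k, r j = r' j) → arkState F A lam c r k = arkState F A lam c r' k
  | 0, _ => rfl
  | k + 1, h => by
    rw [arkState, arkState, arkState_congr c k fun j hj => h j (hj.trans k.lt_succ_self),
      h k k.lt_succ_self]

theorem arkSolve_congr (c : Fin n → ℝ) {r r' : ℕ → Fin n} {k : ℕ} (h : ∀ j < k, r j = r' j) :
    arkSolve F A lam c r k = arkSolve F A lam c r' k := by
  rw [arkSolve, arkSolve, arkState_congr c k h]

theorem isFloatPair_arkState (h : IsParam A lam σ θ (gammaP A lam))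
    (hα : alphaP A lam = θ / (1 + θ)) (hβ : betaP A lam = 1 - θ) (hu : 0 ≤ u)
    (hsmall : 8 ^ 9 * roundUnit n u ≤ 1) {z c : Fin n → ℝ} (hc : ∀ j, F.fl (c j) = c j)
    (hz : c = A.mulVec z) (r : ℕ → Fin n) : ∀ k, IsFloatPair F (arkState F A lam c r k)
  | 0 => ⟨fun _ => F.fl_zero, fun _ => F.fl_zero⟩
  | k + 1 => (arkStep_error h hα hβ hu hsmall hc hz (r k)
      (isFloatPair_arkState h hα hβ hu hsmall hc hz r k)).1

variable {Ω : Type*} [MeasurableSpace Ω] {P : Measure Ω} [IsProbabilityMeasure P]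
  {r : ℕ → Ω → Fin n}

/-- The state after k steps depends only on the draws before k, so the row of step k can be averaged
first with the state frozen. -/
theorem integral_lyap_arkState_succ_le (h : IsParam A lam σ θ (gammaP A lam))
    (hα : alphaP A lam = θ / (1 + θ)) (hβ : betaP A lam = 1 - θ) (hn : 0 < n) (hu : 0 ≤ u)
    (hsmall : 8 ^ 9 * roundUnit n u * (22 * (√(frobSq A) / σ)) ≤ θ / 100)
    {z c : Fin n → ℝ} (hc : ∀ j, F.fl (c j) = c j) (hz : c = A.mulVec z)
    (hr : ∀ j, Measurable (r j)) (hind : iIndepFun r P)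
    (hp : ∀ j i, P {ω | r j ω = i} = ENNReal.ofReal (rowProb A lam i)) (k : ℕ) :
    ∫ ω, lyap A σ (errPair z (arkState F A lam c (fun j => r j ω) (k + 1))) ∂P ≤
      (1 - θ / 4) * ∫ ω, lyap A σ (errPair z (arkState F A lam c (fun j => r j ω) k)) ∂P +
        θ / 1000 * norm2 z ^ 2 := by
  have : Nonempty (Fin n) := ⟨⟨0, hn⟩⟩
  have hsmall' : 8 ^ 9 * roundUnit n u ≤ 1 := by
    have hε0 : 0 ≤ 8 ^ 9 * roundUnit n u :=
      mul_nonneg (by norm_num) (hu.trans (le_roundUnit n hu))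
    nlinarith [h.theta_le_one, h.one_le_cond]
  have h1 := integral_of_disjoint hr hind
    (Finset.disjoint_singleton_right.2 (Finset.notMem_range_self (n := k)))
    (fun x y => lyap A σ (errPair z (arkStep F A lam c (y k) (arkState F A lam c x k))))
    (fun x x' y y' hx hy => by
      rw [hy k (Finset.mem_singleton_self k),
        arkState_congr c k fun j hj => hx j (Finset.mem_range.2 hj)])
  have hint : ∀ f : (Fin n → ℝ) × (Fin n → ℝ) → ℝ,
      Integrable (fun ω => f (arkState F A lam c (fun j => r j ω) k)) P := fun f =>
    integrable_of_finset hr (Finset.range k) (fun x => f (arkState F A lam c x k))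
      fun x y hxy => by rw [arkState_congr c k fun j hj => hxy j (Finset.mem_range.2 hj)]
  refine h1.trans_le ?_
  have h2 : ∀ ω, ∫ ω', lyap A σ (errPair z
      (arkStep F A lam c (r k ω') (arkState F A lam c (fun j => r j ω) k))) ∂P =
      ∑ i, rowProb A lam i * lyap A σ (errPair z
        (arkStep F A lam c i (arkState F A lam c (fun j => r j ω) k))) := fun ω =>
    integral_comp_eq_sum (hr k) h.rowProb_nonneg (hp k) fun i => lyap A σ (errPair z
      (arkStep F A lam c i (arkState F A lam c (fun j => r j ω) k)))
  simp only [h2]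
  calc _ ≤ ∫ ω, ((1 - θ / 4) * lyap A σ (errPair z (arkState F A lam c (fun j => r j ω) k)) +
        θ / 1000 * norm2 z ^ 2) ∂P :=
        integral_mono (hint fun s => ∑ i, rowProb A lam i * lyap A σ (errPair z
          (arkStep F A lam c i s))) (hint fun s => (1 - θ / 4) * lyap A σ (errPair z s) +
          θ / 1000 * norm2 z ^ 2) fun ω => sum_lyap_arkStep_le h hα hβ hn hu hsmall hc hz
            (isFloatPair_arkState h hα hβ hu hsmall' hc hz _ k)
    _ = _ := by
      rw [integral_add ((hint fun s => lyap A σ (errPair z s)).const_mul _) (integrable_const _),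
        integral_const_mul]
      simp

theorem le_geometric_of_succ_le {q : ℕ → ℝ} {a b : ℝ} (ha : 0 ≤ a) (hb : 0 ≤ b)
    (h : ∀ k, q (k + 1) ≤ a * q k + (1 - a) * b) (k : ℕ) : q k ≤ a ^ k * q 0 + b := by
  induction k with
  | zero => simpa using hb
  | succ k ih =>
    refine (h k).trans ((add_le_add_left (mul_le_mul_of_nonneg_left ih ha) _).trans_eq ?_)
    ring

/-- The computed solution of a single solve is correct up to a constant factor in expectation. -/
theorem integral_arkSolve_le (h : IsParam A lam σ θ (gammaP A lam))
    (hα : alphaP A lam = θ / (1 + θ)) (hβ : betaP A lam = 1 - θ) (hn : 0 < n) (hu : 0 ≤ u)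
    (hsmall : 8 ^ 9 * roundUnit n u * (22 * (√(frobSq A) / σ)) ≤ θ / 100)
    {z c : Fin n → ℝ} (hc : ∀ j, F.fl (c j) = c j) (hz : c = A.mulVec z)
    (hr : ∀ j, Measurable (r j)) (hind : iIndepFun r P)
    (hp : ∀ j i, P {ω | r j ω = i} = ENNReal.ofReal (rowProb A lam i)) {k : ℕ}
    (hk : 128 * (√(frobSq A) / σ * √n) ≤ k) :
    ∫ ω, norm2 (arkSolve F A lam c (fun j => r j ω) k - z) ∂P ≤ norm2 z / 4 := by
  have hθ := h.theta_pos
  have hθ1 := h.theta_le_one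
  have hε0 : 0 ≤ roundUnit n u := hu.trans (le_roundUnit n hu)
  have hsmall' : 8 ^ 9 * roundUnit n u ≤ 1 / 1000 := by
    nlinarith [h.one_le_cond]
  have hz0 := norm2_nonneg z
  set Q : ℕ → ℝ := fun k =>
    ∫ ω, lyap A σ (errPair z (arkState F A lam c (fun j => r j ω) k)) ∂P with hQ
  have hQ0 : Q 0 ≤ 4 * norm2 z ^ 2 := by
    have h1 : lyap A σ (errPair z (0, 0)) ≤ 4 * norm2 z ^ 2 := by
      have h2 := h.lyapNorm_le (errPair z (0, 0))
      simp only [errPair, zero_sub, norm2_neg] at h2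
      rw [← lyapNorm_sq]
      have h3 := pow_le_pow_left₀ (lyapNorm_nonneg _) h2 2
      simp only [errPair, zero_sub]
      linarith
    simpa [hQ, arkState] using h1
  -- The additive term θ/1000 is rewritten as (θ/4)(4/1000) to expose the stationary level 4/1000
  -- ‖z‖².
  have hstep : ∀ k, Q (k + 1) ≤ (1 - θ / 4) * Q k +
      (1 - (1 - θ / 4)) * (4 / 1000 * norm2 z ^ 2) := fun k => by
    have := integral_lyap_arkState_succ_le h hα hβ hn hu hsmall hc hz hr hind hp k
    refine this.trans_eq ?_
    ring
  have hgeom := le_geometric_of_succ_le (by linarith) (by positivity) hstep k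
  -- κ√n θ ≥ 1/2 and k ≥ 128 κ√n give kθ/4 ≥ 16, and e⁻¹⁶ ≤ 2⁻¹⁶.
  have hpow : (1 - θ / 4) ^ k ≤ 1 / 65536 := by
    have h1 : (1 - θ / 4) ^ k ≤ Real.exp (k * (-(θ / 4))) := by
      rw [Real.exp_nat_mul]
      exact pow_le_pow_left₀ (by linarith) (by linarith [Real.add_one_le_exp (-(θ / 4))]) k
    have h2 : 1 ≤ 2 * (√(frobSq A) / σ * √n) * θ := by
      rw [show 2 * (√(frobSq A) / σ * √n) * θ = 2 * √n * √(frobSq A) * θ / σ by ring,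
        one_le_div h.sigma_pos]
      exact h.theta_ge
    have h3 : (k : ℝ) * (-(θ / 4)) ≤ (16 : ℕ) * (-1) := by
      have := mul_le_mul_of_nonneg_right hk hθ.le
      push_cast
      linarith
    have h4 : Real.exp (-1) ≤ 1 / 2 := by
      rw [Real.exp_neg, one_div]
      exact inv_anti₀ two_pos (by linarith [Real.add_one_le_exp 1])
    calc (1 - θ / 4) ^ k ≤ _ := h1
      _ ≤ Real.exp ((16 : ℕ) * (-1)) := Real.exp_le_exp.2 h3
      _ = Real.exp (-1) ^ 16 := Real.exp_nat_mul _ _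
      _ ≤ (1 / 2) ^ 16 := pow_le_pow_left₀ (Real.exp_pos _).le h4 16
      _ = _ := by norm_num
  -- 4/65536 + 4/1000 < 0.07². The output then has expected error at most (2.01 · 0.07 + 0.01)‖z‖ <
  -- ‖z‖/4.
  have hQk : Q k ≤ (7 / 100 * norm2 z) ^ 2 := by
    have : (1 - θ / 4) ^ k * Q 0 ≤ 1 / 65536 * (4 * norm2 z ^ 2) :=
      mul_le_mul hpow hQ0 (integral_nonneg fun ω => lyap_nonneg _) (by norm_num)
    nlinarith [sq_nonneg (norm2 z)]
  have hint : ∀ f : (Fin n → ℝ) × (Fin n → ℝ) → ℝ,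
      Integrable (fun ω => f (arkState F A lam c (fun j => r j ω) k)) P := fun f =>
    integrable_of_finset hr (Finset.range k) (fun x => f (arkState F A lam c x k))
      fun x y hxy => by rw [arkState_congr c k fun j hj => hxy j (Finset.mem_range.2 hj)]
  have hN : ∫ ω, lyapNorm A σ (errPair z (arkState F A lam c (fun j => r j ω) k)) ∂P ≤
      7 / 100 * norm2 z := by
    refine le_of_sq_le_sq ?_ (by positivity)
    refine (sq_integral_le (hint fun s => lyapNorm A σ (errPair z s))
      (hint fun s => lyapNorm A σ (errPair z s) ^ 2)).trans ?_
    simp only [lyapNorm_sq]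
    exact hQk
  have hpt : ∀ ω, norm2 (arkSolve F A lam c (fun j => r j ω) k - z) ≤
      (2 + 1 / 100) * lyapNorm A σ (errPair z (arkState F A lam c (fun j => r j ω) k)) +
        1 / 100 * norm2 z := fun ω => by
    set s := arkState F A lam c (fun j => r j ω) k with hs
    have e1 := (approx_arkX_of_pair h hα hu (by linarith) z
      (isFloatPair_arkState h hα hβ hu (by linarith) hc hz (fun j => r j ω) k)).2.2
    rw [← hs] at e1
    set x := (θ / (1 + θ)) • s.1 + (1 - θ / (1 + θ)) • s.2 with hx
    have hN0 : 0 ≤ lyapNorm A σ (errPair z s) := lyapNorm_nonneg _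
    have e2 : norm2 (x - z) ≤ 2 * lyapNorm A σ (errPair z s) := by
      have e3 : x - z = (θ / (1 + θ)) • (errPair z s).1 + (1 - θ / (1 + θ)) • (errPair z s).2 := by
        rw [hx, errPair]; module
      have e4 := norm2_add_le ((θ / (1 + θ)) • (errPair z s).1)
        ((1 - θ / (1 + θ)) • (errPair z s).2)
      rw [← e3, norm2_smul, norm2_smul, abs_of_nonneg h.alpha_nonneg,
        abs_of_nonneg (sub_nonneg.2 h.alpha_le_one)] at e4
      have e5 : θ / (1 + θ) * norm2 (errPair z s).1 ≤ lyapNorm A σ (errPair z s) := by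
        calc _ ≤ θ * (√(frobSq A) / σ * lyapNorm A σ (errPair z s)) :=
              mul_le_mul h.alpha_le (h.norm2_fst_le _) (norm2_nonneg _) hθ.le
          _ = θ * (√(frobSq A) / σ) * lyapNorm A σ (errPair z s) := by ring
          _ ≤ _ := mul_le_of_le_one_left hN0 h.theta_cond
      have e6 : (1 - θ / (1 + θ)) * norm2 (errPair z s).2 ≤ lyapNorm A σ (errPair z s) :=
        (mul_le_of_le_one_left (norm2_nonneg _) (by linarith [h.alpha_nonneg])).trans
          (norm2_snd_le_lyapNorm _)
      linarith
    have e7 : norm2 (arkX F A lam s.1 s.2 - z) ≤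
        norm2 (arkX F A lam s.1 s.2 - x) + norm2 (x - z) := by
      have := norm2_add_le (arkX F A lam s.1 s.2 - x) (x - z)
      rwa [sub_add_sub_cancel] at this
    have e8 : 8 ^ 3 * roundUnit n u * (3 * (lyapNorm A σ (errPair z s) + norm2 z)) ≤
        1 / 300 * (3 * (lyapNorm A σ (errPair z s) + norm2 z)) :=
      mul_le_mul_of_nonneg_right (by linarith) (by positivity)
    have e9 : arkSolve F A lam c (fun j => r j ω) k = arkX F A lam s.1 s.2 := rfl
    rw [e9]
    linarith
  calc _ ≤ ∫ ω, ((2 + 1 / 100) *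
        lyapNorm A σ (errPair z (arkState F A lam c (fun j => r j ω) k)) +
        1 / 100 * norm2 z) ∂P :=
        integral_mono (hint fun s => norm2 (arkX F A lam s.1 s.2 - z))
          (hint fun s => (2 + 1 / 100) * lyapNorm A σ (errPair z s) + 1 / 100 * norm2 z) hpt
    _ = (2 + 1 / 100) *
        ∫ ω, lyapNorm A σ (errPair z (arkState F A lam c (fun j => r j ω) k)) ∂P +
        1 / 100 * norm2 z := by
      rw [integral_add ((hint fun s => lyapNorm A σ (errPair z s)).const_mul _)
        (integrable_const _), integral_const_mul]
      simp
    _ ≤ _ := by linarith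

end Solve

/-! ### Iterative refinement -/

section Refinement

variable {n : ℕ} {A : Matrix (Fin n) (Fin n) ℝ} {lam σ θ u : ℝ} {F : FloatArith u}

open FloatArith

theorem refine_congr (b : Fin n → ℝ) (k : ℕ → ℕ) {r r' : ℕ → ℕ → Fin n} :
    ∀ i, (∀ a ≤ i, ∀ j < k a, r a j = r' a j) →
      refine F A lam b r k i = refine F A lam b r' k i
  | 0, h => arkSolve_congr _ (h 0 le_rfl)
  | i + 1, h => by
    rw [refine, refine, refine_congr b k i fun a ha => h a (ha.trans i.le_succ),
      arkSolve_congr _ (h (i + 1) le_rfl)]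

theorem eq_mulVec_inv_mulVec (h : IsParam A lam σ θ (gammaP A lam)) (c : Fin n → ℝ) :
    c = A.mulVec (A⁻¹.mulVec c) := by
  rw [Matrix.mulVec_mulVec, Matrix.mul_nonsing_inv A h.det, Matrix.one_mulVec]

theorem fl_arkSolve (h : IsParam A lam σ θ (gammaP A lam)) (hα : alphaP A lam = θ / (1 + θ))
    (hβ : betaP A lam = 1 - θ) (hu : 0 ≤ u) (hsmall : 8 ^ 9 * roundUnit n u ≤ 1)
    {c : Fin n → ℝ} (hc : ∀ j, F.fl (c j) = c j) (r : ℕ → Fin n) (k : ℕ) (j : Fin n) :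
    F.fl (arkSolve F A lam c r k j) = arkSolve F A lam c r k j :=
  (approx_arkX_of_pair h hα hu (by linarith [hu.trans (le_roundUnit n hu)]) (A⁻¹.mulVec c)
    (isFloatPair_arkState h hα hβ hu hsmall hc (eq_mulVec_inv_mulVec h c) r k)).1 j

/-- The computed residual `b - A x'`. -/
noncomputable def residual (F : FloatArith u) (A : Matrix (Fin n) (Fin n) ℝ) (b x' : Fin n → ℝ) :
    Fin n → ℝ :=
  F.vsub (F.flVec b) (F.mulVec (F.flMat A) x')

theorem approx_residual (hu : 0 ≤ u) (hsmall : 8 * roundUnit n u ≤ 1) {x x' : Fin n → ℝ}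
    (hx' : ∀ j, F.fl (x' j) = x' j) :
    F.Approx (8 ^ 2 * roundUnit n u) (residual F A (A.mulVec x) x') (A.mulVec (x - x'))
      (√(frobSq A) * (norm2 x + norm2 x')) := by
  have hε := le_roundUnit n hu
  have hεdef : 4 * ((n + 2) * u) = roundUnit n u := rfl
  set ε := roundUnit n u
  have hε0 : 0 ≤ ε := hu.trans hε
  have hrow : ∀ i, F.ApproxScalar (8 * ε) (F.mulVec (F.flMat A) x' i) (A.mulVec x' i)
      (norm2 (A i) * norm2 x') := fun i =>
    (approx_flMat_row (F := F) A i hε hu).dot hu hεdef.le (by linarith)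
      (approx_self hx' hε0 le_rfl)
  have h1 : F.Approx (8 * ε) (F.mulVec (F.flMat A) x') (A.mulVec x')
      (√(frobSq A) * norm2 x') := by
    refine ⟨fun i => (hrow i).1, norm2_mulVec_le A x', ?_⟩
    refine (norm2_le_mul_sqrt_frobSq A (c := 8 * ε * norm2 x')
      (mul_nonneg (by positivity) (norm2_nonneg _)) fun i => ?_).trans_eq (by ring)
    exact (hrow i).2.2.trans_eq (by ring)
  have h2 : F.Approx (8 * ε) (F.flVec (A.mulVec x)) (A.mulVec x) (√(frobSq A) * norm2 x) :=
    approx_flVec (by linarith) (norm2_mulVec_le A x) hu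
  have h3 := h2.vsub hu (by linarith) hsmall h1
  rw [← mul_add, ← Matrix.mulVec_sub] at h3
  exact h3.mono (by positivity) (by linarith) le_rfl

/-- The residual error is relative to ‖A‖_F(‖x‖ + ‖x'‖), and A⁻¹ amplifies it by at most 1/σ. The
part in ‖x‖ sets the attainable accuracy; the part in the current error is absorbed by the
contraction. -/
theorem norm2_inv_residual_sub_le (h : IsParam A lam σ θ (gammaP A lam)) (hu : 0 ≤ u)
    (hsmall : 8 * roundUnit n u ≤ 1) {x x' : Fin n → ℝ} (hx' : ∀ j, F.fl (x' j) = x' j) :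
    norm2 (A⁻¹.mulVec (residual F A (A.mulVec x) x') - (x - x')) ≤
      8 ^ 2 * roundUnit n u * (√(frobSq A) / σ) * (2 * norm2 x + norm2 (x' - x)) := by
  have hε0 := hu.trans (le_roundUnit n hu)
  have h1 := (approx_residual (A := A) hu hsmall (x := x) hx').2.2
  have h2 := h.sigma_inv (residual F A (A.mulVec x) x' - A.mulVec (x - x'))
  have h3 : A⁻¹.mulVec (residual F A (A.mulVec x) x' - A.mulVec (x - x')) =
      A⁻¹.mulVec (residual F A (A.mulVec x) x') - (x - x') := by
    rw [Matrix.mulVec_sub, Matrix.mulVec_mulVec (x - x') A⁻¹ A, Matrix.nonsing_inv_mul A h.det,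
      Matrix.one_mulVec]
  rw [h3] at h2
  have h4 : norm2 x + norm2 x' ≤ 2 * norm2 x + norm2 (x' - x) := by
    linarith [norm2_le_norm2_add x' x]
  calc _ = σ * norm2 (A⁻¹.mulVec (residual F A (A.mulVec x) x') - (x - x')) / σ := by
        field_simp [h.sigma_pos.ne']
    _ ≤ 8 ^ 2 * roundUnit n u * (√(frobSq A) * (2 * norm2 x + norm2 (x' - x))) / σ := by
        refine div_le_div_of_nonneg_right ((h2.trans h1).trans ?_) h.sigma_pos.le
        gcongr
    _ = _ := by ring

theorem fl_refine (h : IsParam A lam σ θ (gammaP A lam)) (hα : alphaP A lam = θ / (1 + θ))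
    (hβ : betaP A lam = 1 - θ) (hu : 0 ≤ u) (hsmall : 8 ^ 9 * roundUnit n u ≤ 1)
    (x : Fin n → ℝ) (r : ℕ → ℕ → Fin n) (k : ℕ → ℕ) :
    ∀ i j, F.fl (refine F A lam (A.mulVec x) r k i j) = refine F A lam (A.mulVec x) r k i j
  | 0, j => fl_arkSolve h hα hβ hu hsmall (fun _ => F.fl_fl _) _ _ j
  | i + 1, j => by
    have hε0 := hu.trans (le_roundUnit n hu)
    have ih := fl_refine h hα hβ hu hsmall x r k i
    exact F.fl_add _ _ (ih j) (fl_arkSolve h hα hβ hu hsmall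
      (approx_residual (A := A) hu (by linarith) (x := x) ih).1 _ _ j)

variable {Ω : Type*} [MeasurableSpace Ω] {P : Measure Ω} [IsProbabilityMeasure P]
  {r : ℕ × ℕ → Ω → Fin n}

/-- The indices of the draws used by solve number `i`. -/
def drawsOf (k : ℕ → ℕ) (i : ℕ) : Finset (ℕ × ℕ) := {i} ×ˢ Finset.range (k i)

/-- The indices of the draws used up to solve number `i`. -/
def drawsUpTo (k : ℕ → ℕ) (i : ℕ) : Finset (ℕ × ℕ) :=
  (Finset.range (i + 1)).biUnion (drawsOf k)

theorem mem_drawsOf {k : ℕ → ℕ} {i j : ℕ} (h : j < k i) : (i, j) ∈ drawsOf k i := by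
  simpa [drawsOf] using h

theorem mem_drawsUpTo {k : ℕ → ℕ} {i a j : ℕ} (ha : a ≤ i) (h : j < k a) :
    (a, j) ∈ drawsUpTo k i :=
  Finset.mem_biUnion.2 ⟨a, Finset.mem_range.2 (Nat.lt_succ_of_le ha), mem_drawsOf h⟩

theorem disjoint_draws (k : ℕ → ℕ) (i : ℕ) : Disjoint (drawsUpTo k i) (drawsOf k (i + 1)) := by
  rw [Finset.disjoint_left]
  rintro ⟨a, j⟩ h1 h2
  simp only [drawsUpTo, drawsOf, Finset.mem_biUnion, Finset.mem_product, Finset.mem_range,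
    Finset.mem_singleton] at h1 h2
  lia

theorem integrable_refine (hr : ∀ p, Measurable (r p)) (b : Fin n → ℝ) (k : ℕ → ℕ) (i : ℕ)
    (f : (Fin n → ℝ) → ℝ) :
    Integrable (fun ω => f (refine F A lam b (fun a j => r (a, j) ω) k i)) P :=
  integrable_of_finset hr (drawsUpTo k i)
    (fun x => f (refine F A lam b (fun a j => x (a, j)) k i)) fun x y hxy => by
      rw [refine_congr b k i fun a ha j hj => hxy _ (mem_drawsUpTo ha hj)]

/-- The solve targets z = A⁻¹ fl(b), and ‖z - x‖ ≤ κu‖x‖, so the quarter from the solve leaves room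
within one half. -/
theorem integral_refine_zero_le (h : IsParam A lam σ θ (gammaP A lam))
    (hα : alphaP A lam = θ / (1 + θ)) (hβ : betaP A lam = 1 - θ) (hn : 0 < n) (hu : 0 ≤ u)
    (hsmall : 8 ^ 9 * roundUnit n u * (22 * (√(frobSq A) / σ)) ≤ θ / 100)
    (x : Fin n → ℝ) (hr : ∀ p, Measurable (r p)) (hind : iIndepFun r P)
    (hp : ∀ p i, P {ω | r p ω = i} = ENNReal.ofReal (rowProb A lam i)) {k : ℕ → ℕ}
    (hk : 128 * (√(frobSq A) / σ * √n) ≤ k 0) :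
    ∫ ω, norm2 (refine F A lam (A.mulVec x) (fun a j => r (a, j) ω) k 0 - x) ∂P ≤
      norm2 x / 2 := by
  have hκ := h.one_le_cond
  have hε := le_roundUnit n hu
  have hε0 := hu.trans hε
  have hθ1 := h.theta_le_one
  have hx0 := norm2_nonneg x
  set κ := √(frobSq A) / σ with hκdef
  set c := F.flVec (A.mulVec x) with hc
  set z := A⁻¹.mulVec c with hz
  have h1 := integral_arkSolve_le h hα hβ hn hu hsmall (F := F) (c := c) (fun _ => F.fl_fl _)
    (eq_mulVec_inv_mulVec h c) (r := fun j => r (0, j)) (fun j => hr _)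
    (hind.precomp (Prod.mk_right_injective 0)) (fun j => hp _) hk
  rw [← hz] at h1
  have h2 : norm2 (z - x) ≤ 1 / 100 * norm2 x := by
    have e1 : z - x = A⁻¹.mulVec (c - A.mulVec x) := by
      rw [Matrix.mulVec_sub, Matrix.mulVec_mulVec, Matrix.nonsing_inv_mul A h.det,
        Matrix.one_mulVec]
    have e2 : norm2 (c - A.mulVec x) ≤ u * norm2 (A.mulVec x) :=
      norm2_le_mul hu fun j => F.fl_err _
    have e3 := h.sigma_inv (c - A.mulVec x)
    rw [← e1] at e3
    have e4 := mul_le_mul_of_nonneg_left (norm2_mulVec_le A x) hu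
    calc norm2 (z - x) = σ * norm2 (z - x) / σ := by field_simp [h.sigma_pos.ne']
      _ ≤ u * (√(frobSq A) * norm2 x) / σ :=
        div_le_div_of_nonneg_right (e3.trans (e2.trans e4)) h.sigma_pos.le
      _ = u * κ * norm2 x := by rw [hκdef]; ring
      _ ≤ _ := by
        refine mul_le_mul_of_nonneg_right ?_ hx0
        have : u * κ ≤ roundUnit n u * κ := by gcongr
        have : 0 ≤ roundUnit n u * κ := by positivity
        linarith
  have hint := fun f => integrable_refine (F := F) (A := A) (lam := lam) (P := P) hr
    (A.mulVec x) k 0 f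
  calc _ ≤ ∫ ω, (norm2 (refine F A lam (A.mulVec x) (fun a j => r (a, j) ω) k 0 - z) +
        norm2 (z - x)) ∂P :=
        integral_mono (hint fun y => norm2 (y - x)) (hint fun y => norm2 (y - z) + norm2 (z - x))
          fun ω => by
            have := norm2_add_le
              (refine F A lam (A.mulVec x) (fun a j => r (a, j) ω) k 0 - z) (z - x)
            rwa [sub_add_sub_cancel] at this
    _ = ∫ ω, norm2 (refine F A lam (A.mulVec x) (fun a j => r (a, j) ω) k 0 - z) ∂P +
        norm2 (z - x) := by
      rw [integral_add (hint fun y => norm2 (y - z)) (integrable_const _)]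
      simp
    _ ≤ norm2 z / 4 + norm2 (z - x) := add_le_add_left h1 _
    _ ≤ _ := by linarith [norm2_le_norm2_add z x]

/-- The new error splits into the rounding of the update, the error of the solve for z =
A⁻¹(residual), and the distance from z to the true correction x - X. The solve uses fresh draws, so
its bound ‖z‖/4 holds with X frozen, and ‖z‖ is close to ‖X - x‖; the total factor, slightly above
1/4, is relaxed to 1/2. -/
theorem integral_refine_succ_le (h : IsParam A lam σ θ (gammaP A lam))
    (hα : alphaP A lam = θ / (1 + θ)) (hβ : betaP A lam = 1 - θ) (hn : 0 < n) (hu : 0 ≤ u)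
    (hsmall : 8 ^ 9 * roundUnit n u * (22 * (√(frobSq A) / σ)) ≤ θ / 100)
    (x : Fin n → ℝ) (hr : ∀ p, Measurable (r p)) (hind : iIndepFun r P)
    (hp : ∀ p i, P {ω | r p ω = i} = ENNReal.ofReal (rowProb A lam i)) {k : ℕ → ℕ} {i : ℕ}
    (hk : 128 * (√(frobSq A) / σ * √n) ≤ k (i + 1)) :
    ∫ ω, norm2 (refine F A lam (A.mulVec x) (fun a j => r (a, j) ω) k (i + 1) - x) ∂P ≤
      1 / 2 * ∫ ω, norm2 (refine F A lam (A.mulVec x) (fun a j => r (a, j) ω) k i - x) ∂P +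
        5 * (8 ^ 2 * roundUnit n u * (√(frobSq A) / σ)) * norm2 x := by
  have : Nonempty (Fin n) := ⟨⟨0, hn⟩⟩
  have hκ := h.one_le_cond
  have hε := le_roundUnit n hu
  have hε0 := hu.trans hε
  have hθ1 := h.theta_le_one
  have hx0 := norm2_nonneg x
  have hsmall' : 8 ^ 9 * roundUnit n u ≤ 1 := by nlinarith
  set κ := √(frobSq A) / σ with hκdef
  have hη : 8 ^ 2 * roundUnit n u * κ ≤ 1 / 1000 := by
    have : 0 ≤ roundUnit n u * κ := by positivity
    linarith
  have huη : u ≤ 8 ^ 2 * roundUnit n u * κ := by nlinarith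
  set η := 8 ^ 2 * roundUnit n u * κ with hηdef
  have hη0 : 0 ≤ η := hu.trans huη
  set X : Ω → Fin n → ℝ := fun ω => refine F A lam (A.mulVec x) (fun a j => r (a, j) ω) k i
  set z : (Fin n → ℝ) → Fin n → ℝ := fun y => A⁻¹.mulVec (residual F A (A.mulVec x) y) with hzdef
  set D : Ω → ℝ := fun ω => norm2 (arkSolve F A lam (residual F A (A.mulVec x) (X ω))
    (fun j => r (i + 1, j) ω) (k (i + 1)) - z (X ω)) with hD
  have hfl : ∀ ω j, F.fl (X ω j) = X ω j := fun ω =>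
    fl_refine h hα hβ hu hsmall' x (fun a j => r (a, j) ω) k i
  have hΔ : ∀ ω, norm2 (z (X ω) - (x - X ω)) ≤ η * (2 * norm2 x + norm2 (X ω - x)) := fun ω =>
    norm2_inv_residual_sub_le h hu (by linarith) (hfl ω)
  have hint : ∀ f : (Fin n → ℝ) → ℝ, Integrable (fun ω => f (X ω)) P := fun f =>
    integrable_refine hr (A.mulVec x) k i f
  have hDint : Integrable D P :=
    integrable_of_finset hr (drawsUpTo k (i + 1)) (fun q => norm2 (arkSolve F A lam
      (residual F A (A.mulVec x) (refine F A lam (A.mulVec x) (fun a j => q (a, j)) k i))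
      (fun j => q (i + 1, j)) (k (i + 1)) -
        z (refine F A lam (A.mulVec x) (fun a j => q (a, j)) k i))) fun q q' hq => by
        rw [refine_congr _ k i fun a ha j hj => hq _ (mem_drawsUpTo (ha.trans i.le_succ) hj),
          arkSolve_congr _ fun j hj => hq _ (mem_drawsUpTo le_rfl hj)]
  have hDle : ∫ ω, D ω ∂P ≤ ∫ ω, norm2 (z (X ω)) / 4 ∂P := by
    have e1 := integral_of_disjoint hr hind (disjoint_draws k i) (fun q q' => norm2 (arkSolve F A lam
      (residual F A (A.mulVec x) (refine F A lam (A.mulVec x) (fun a j => q (a, j)) k i))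
      (fun j => q' (i + 1, j)) (k (i + 1)) -
        z (refine F A lam (A.mulVec x) (fun a j => q (a, j)) k i))) fun q q' p p' hq hp' => by
        rw [refine_congr _ k i fun a ha j hj => hq _ (mem_drawsUpTo ha hj),
          arkSolve_congr _ fun j hj => hp' _ (mem_drawsOf hj)]
    refine e1.trans_le (integral_mono (hint fun y => ∫ ω', norm2 (arkSolve F A lam
      (residual F A (A.mulVec x) y) (fun j => r (i + 1, j) ω') (k (i + 1)) - z y) ∂P)
      (hint fun y => norm2 (z y) / 4) fun ω => ?_)
    exact integral_arkSolve_le h hα hβ hn hu hsmall (F := F)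
      (approx_residual (A := A) hu (by linarith) (x := x) (hfl ω)).1
      (eq_mulVec_inv_mulVec h _) (r := fun j => r (i + 1, j)) (fun j => hr _)
      (hind.precomp (Prod.mk_right_injective (i + 1))) (fun j => hp _) hk
  have hz : ∀ ω, norm2 (z (X ω)) ≤
      (1 + 1 / 1000) * norm2 (X ω - x) + 2 * η * norm2 x := fun ω => by
    have e1 := norm2_le_norm2_add (z (X ω)) (x - X ω)
    have e2 : norm2 (x - X ω) = norm2 (X ω - x) := by rw [← norm2_neg, neg_sub]
    have e3 := mul_le_mul_of_nonneg_right hη (norm2_nonneg (X ω - x))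
    linarith [hΔ ω]
  have hpt : ∀ ω, norm2 (refine F A lam (A.mulVec x) (fun a j => r (a, j) ω) k (i + 1) - x) ≤
      (1 + 1 / 1000) * D ω + 2 / 1000 * norm2 (X ω - x) + 4 * η * norm2 x := fun ω => by
    set d := arkSolve F A lam (residual F A (A.mulVec x) (X ω))
      (fun j => r (i + 1, j) ω) (k (i + 1)) with hd
    have e0 : refine F A lam (A.mulVec x) (fun a j => r (a, j) ω) k (i + 1) = F.vadd (X ω) d := rfl
    have e1 : norm2 (F.vadd (X ω) d - (X ω + d)) ≤ u * norm2 (X ω + d) :=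
      norm2_le_mul hu fun j => F.add_err _ _ (hfl ω j) (fl_arkSolve h hα hβ hu hsmall'
        (approx_residual (A := A) hu (by linarith) (x := x) (hfl ω)).1 _ _ j)
    have e2 : norm2 (X ω + d - x) ≤ D ω + norm2 (z (X ω) - (x - X ω)) := by
      have := norm2_add_le (d - z (X ω)) (z (X ω) - (x - X ω))
      rwa [show d - z (X ω) + (z (X ω) - (x - X ω)) = X ω + d - x by abel] at this
    have e3 := norm2_le_norm2_add (X ω + d) x
    have e4 : norm2 (F.vadd (X ω) d - x) ≤
        norm2 (F.vadd (X ω) d - (X ω + d)) + norm2 (X ω + d - x) := by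
      have := norm2_add_le (F.vadd (X ω) d - (X ω + d)) (X ω + d - x)
      rwa [sub_add_sub_cancel] at this
    have e5 : u * norm2 (X ω + d) ≤ η * norm2 x + 1 / 1000 * norm2 (X ω + d - x) := by
      have f1 := mul_le_mul_of_nonneg_left e3 hu
      have f2 := mul_le_mul_of_nonneg_right huη hx0
      have f3 := mul_le_mul_of_nonneg_right (huη.trans hη) (norm2_nonneg (X ω + d - x))
      linarith
    have e6 := hΔ ω
    have e7 := mul_le_mul_of_nonneg_right hη (norm2_nonneg (X ω - x))
    have e8 : 0 ≤ η * norm2 x := mul_nonneg hη0 hx0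
    have e9 := norm2_nonneg (X ω - x)
    rw [e0]
    linarith
  have hE := integral_mono (integrable_refine hr (A.mulVec x) k (i + 1) fun y => norm2 (y - x))
    (((hDint.const_mul (1 + 1 / 1000)).add (hint fun y => 2 / 1000 * norm2 (y - x))).add
      (integrable_const (4 * η * norm2 x))) hpt
  have hI : ∫ ω, norm2 (z (X ω)) / 4 ∂P ≤
      ∫ ω, ((1 + 1 / 1000) / 4 * norm2 (X ω - x) + η / 2 * norm2 x) ∂P :=
    integral_mono (hint fun y => norm2 (z y) / 4)
      (hint fun y => (1 + 1 / 1000) / 4 * norm2 (y - x) + η / 2 * norm2 x) fun ω => by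
        linarith [hz ω]
  have hE' : ∫ ω, ((1 + 1 / 1000) * D ω + 2 / 1000 * norm2 (X ω - x) + 4 * η * norm2 x) ∂P =
      (1 + 1 / 1000) * ∫ ω, D ω ∂P + 2 / 1000 * ∫ ω, norm2 (X ω - x) ∂P + 4 * η * norm2 x := by
    have g1 : Integrable (fun ω => (1 + 1 / 1000) * D ω + 2 / 1000 * norm2 (X ω - x)) P :=
      (hDint.const_mul _).add (hint fun y => 2 / 1000 * norm2 (y - x))
    rw [integral_add g1 (integrable_const _), integral_add (hDint.const_mul _)
      (hint fun y => 2 / 1000 * norm2 (y - x)), integral_const_mul, integral_const_mul]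
    simp
  have hI' : ∫ ω, ((1 + 1 / 1000) / 4 * norm2 (X ω - x) + η / 2 * norm2 x) ∂P =
      (1 + 1 / 1000) / 4 * ∫ ω, norm2 (X ω - x) ∂P + η / 2 * norm2 x := by
    rw [integral_add (hint fun y => (1 + 1 / 1000) / 4 * norm2 (y - x)) (integrable_const _),
      integral_const_mul]
    simp
  have hpos : 0 ≤ ∫ ω, norm2 (X ω - x) ∂P := integral_nonneg fun ω => norm2_nonneg _
  have hηx : 0 ≤ η * norm2 x := mul_nonneg hη0 hx0
  refine hE.trans (hE'.le.trans ?_)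
  linarith

/-- The last term is twice the additive error of one refinement, the fixed point of the recursion q
↦ q/2 + 5η‖x‖. The exponent is t + 1 because the initial solve also halves. -/
theorem integral_refine_le (h : IsParam A lam σ θ (gammaP A lam))
    (hα : alphaP A lam = θ / (1 + θ)) (hβ : betaP A lam = 1 - θ) (hn : 0 < n) (hu : 0 ≤ u)
    (hsmall : 8 ^ 9 * roundUnit n u * (22 * (√(frobSq A) / σ)) ≤ θ / 100)
    (x : Fin n → ℝ) (hr : ∀ p, Measurable (r p)) (hind : iIndepFun r P)
    (hp : ∀ p i, P {ω | r p ω = i} = ENNReal.ofReal (rowProb A lam i)) {k : ℕ → ℕ} (t : ℕ)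
    (hk : ∀ i ≤ t, 128 * (√(frobSq A) / σ * √n) ≤ k i) :
    ∫ ω, norm2 (refine F A lam (A.mulVec x) (fun a j => r (a, j) ω) k t - x) ∂P ≤
      (1 / 2) ^ (t + 1) * norm2 x +
        10 * (8 ^ 2 * roundUnit n u * (√(frobSq A) / σ)) * norm2 x := by
  have hη : 0 ≤ 10 * (8 ^ 2 * roundUnit n u * (√(frobSq A) / σ)) * norm2 x :=
    mul_nonneg (mul_nonneg (by norm_num) (mul_nonneg (mul_nonneg (by norm_num)
      (hu.trans (le_roundUnit n hu))) (zero_le_one.trans h.one_le_cond))) (norm2_nonneg x)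
  induction t with
  | zero =>
    have := integral_refine_zero_le (F := F) h hα hβ hn hu hsmall x hr hind hp (hk 0 le_rfl)
    rw [zero_add, pow_one]
    linarith
  | succ t ih =>
    have h1 := integral_refine_succ_le (F := F) h hα hβ hn hu hsmall x hr hind hp (hk (t + 1) le_rfl)
    have h2 := ih fun i hi => hk i (hi.trans t.le_succ)
    rw [pow_succ]
    linarith

/-- The halving by the initial solve makes up for rounding the logarithm down. The natural-number
floor also covers δ > 1, where it is 0. -/
theorem half_pow_le_of_floor_logb_le {δ : ℝ} (hδ : 0 < δ) {t : ℕ}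
    (ht : ⌊Real.logb 2 (1 / δ)⌋₊ ≤ t) : (1 / 2 : ℝ) ^ (t + 1) ≤ δ := by
  have h1 : Real.logb 2 (1 / δ) < ((t + 1 : ℕ) : ℝ) := by
    refine (Nat.lt_floor_add_one _).trans_le ?_
    exact_mod_cast Nat.succ_le_succ ht
  rw [Real.logb_lt_iff_lt_rpow one_lt_two (by positivity), Real.rpow_natCast] at h1
  rw [one_div, inv_pow]
  exact inv_le_of_inv_le₀ hδ (by rw [← one_div]; exact h1.le)

/-- Multiplying nuκ by 2√n κθ ≥ 1 turns it into a multiple of κ²u · θ; thus one factor κ comes from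
the rounding error and the other from the contraction rate. -/
theorem rounding_small (h : IsParam A lam σ θ (gammaP A lam)) (hu : 0 ≤ u)
    (hκ : (√(frobSq A) / σ) ^ 2 * u ≤ 1 / (10 ^ 13 * (n + 2) ^ 2)) :
    8 ^ 9 * roundUnit n u * (22 * (√(frobSq A) / σ)) ≤ θ / 100 := by
  have hκ1 := h.one_le_cond
  set κ := √(frobSq A) / σ with hκdef
  have h1 : 1 ≤ 2 * √n * κ * θ := by
    rw [hκdef, show 2 * √n * (√(frobSq A) / σ) * θ = 2 * √n * √(frobSq A) * θ / σ by ring,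
      one_le_div h.sigma_pos]
    exact h.theta_ge
  have h2 : √(n : ℝ) ≤ n + 2 := by
    refine Real.sqrt_le_iff.2 ⟨by positivity, ?_⟩
    have : (0 : ℝ) ≤ n := n.cast_nonneg
    nlinarith
  rw [le_div_iff₀ (by positivity)] at hκ
  have h3 : 8 ^ 9 * 88 * ((n + 2) * u * κ) ≤ 8 ^ 9 * 88 * ((n + 2) * u * κ) * (2 * √n * κ * θ) :=
    le_mul_of_one_le_right (by positivity) h1
  have h4 : (n + 2) * u * κ * (2 * √n * κ * θ) ≤ 2 * (κ ^ 2 * u * (n + 2) ^ 2) * θ := by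
    have : (n + 2) * √(n : ℝ) ≤ (n + 2) ^ 2 := by nlinarith
    have := mul_le_mul_of_nonneg_left this
      (show 0 ≤ 2 * (κ ^ 2 * u) * θ from mul_nonneg (by positivity) h.theta_pos.le)
    linarith
  have h5 : κ ^ 2 * u * (n + 2) ^ 2 * θ ≤ 1 / 10 ^ 13 * θ :=
    mul_le_mul_of_nonneg_right (by linarith) h.theta_pos.le
  have h6 := h.theta_pos
  rw [roundUnit]
  linarith

end Refinement

end ARK

theorem theorem4p3 :
    ∃ (K : ℝ) (C₀ C₁ : Polynomial ℝ), 0 < K ∧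
      (∀ n : ℕ, 0 < C₀.eval (n : ℝ)) ∧ (∀ n : ℕ, 0 < C₁.eval (n : ℝ)) ∧
      ∀ (n : ℕ) (A : Matrix (Fin n) (Fin n) ℝ) (b : Fin n → ℝ) (lam u : ℝ)
        (F : ARK.FloatArith u) (k : ℕ → ℕ) (t : ℕ)
        (Ω : Type*) [MeasurableSpace Ω] (P : Measure Ω) [IsProbabilityMeasure P]
        (r : ℕ × ℕ → Ω → Fin n),
        IsUnit A.det →
        ARK.AdmissibleReg A lam →
        0 < u →
        ARK.demmel A ^ 2 * u ≤ 1 / C₀.eval (n : ℝ) →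
        -- number of refinements (initial solve not counted)
        ⌊Real.logb 2 (1 / (ARK.demmel A * u))⌋₊ ≤ t →
        -- number of iterations in the initial solve and in each refinement
        (∀ i ≤ t, K * (ARK.demmel A * Real.sqrt n) ≤ k i) →
        -- all row draws are independent, with the regularized row probabilities
        (∀ p, Measurable (r p)) →
        iIndepFun r P →
        (∀ p i, P {ω | r p ω = i} = ENNReal.ofReal (ARK.rowProb A lam i)) →
        Integrable (fun ω =>
            ARK.norm2 (ARK.refine F A lam b (fun i j => r (i, j) ω) k t - A⁻¹.mulVec b)) P ∧
          ∫ ω, ARK.norm2 (ARK.refine F A lam b (fun i j => r (i, j) ω) k t - A⁻¹.mulVec b) ∂P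
            ≤ C₁.eval (n : ℝ) * (ARK.norm2 (A⁻¹.mulVec b) * (ARK.demmel A * u)) := by
  -- C₀ is dictated by `rounding_small`. In C₁, 10 · 8² · 4 = 2560 multiplies n + 2 for the limiting
  -- accuracy, and the extra unit in n + 3 covers (1/2)^(t+1) ≤ κu.
  refine ⟨128, 10 ^ 13 * (Polynomial.X + 2) ^ 2, 2560 * (Polynomial.X + 3), by norm_num,
    fun n => ?_, fun n => ?_, ?_⟩
  · simp only [Polynomial.eval_mul, Polynomial.eval_pow, Polynomial.eval_add, Polynomial.eval_X,
      Polynomial.eval_ofNat]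
    positivity
  · simp only [Polynomial.eval_mul, Polynomial.eval_add, Polynomial.eval_X, Polynomial.eval_ofNat]
    positivity
  intro n A b lam u F k t Ω _ P _ r hA hlam hu hκ ht hk hr hind hp
  simp only [Polynomial.eval_mul, Polynomial.eval_pow, Polynomial.eval_add, Polynomial.eval_X,
    Polynomial.eval_ofNat] at hκ ⊢
  refine ⟨ARK.integrable_refine hr b k t fun y => ARK.norm2 (y - A⁻¹.mulVec b), ?_⟩
  -- A probability space is nonempty, so a draw exists and `Fin n` cannot be empty.
  have hn : 0 < n := by
    obtain ⟨ω⟩ := P.nonempty_of_neZero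
    exact (Nat.zero_le _).trans_lt (r (0, 0) ω).2
  obtain ⟨θ, h, hα, hβ⟩ := ARK.exists_isParam hn hA hlam
  rw [ARK.demmel_eq hn hA] at *
  have hb := ARK.eq_mulVec_inv_mulVec h b
  set x := A⁻¹.mulVec b with hx
  have hκ1 := h.one_le_cond
  have h1 := ARK.integral_refine_le h hα hβ hn hu.le (ARK.rounding_small h hu.le hκ) x hr hind hp
    (F := F) t hk
  rw [← hb] at h1
  set κ := √(ARK.frobSq A) / ARK.sigmaMin A
  have h2 := ARK.half_pow_le_of_floor_logb_le (mul_pos (zero_lt_one.trans_le hκ1) hu) ht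
  have h3 := mul_le_mul_of_nonneg_right h2 (ARK.norm2_nonneg x)
  refine h1.trans ?_
  rw [ARK.roundUnit]
  have h4 : 0 ≤ κ * u * ARK.norm2 x := by
    have := ARK.norm2_nonneg x
    positivity
  linarith
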